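/- Let $n\ge 2$, let $a_1,\dots,a_n>0$, and put $A=\mathrm{diag}(a_1,\dots,a_n)$, $\bar A=\mathrm{diag}(a_1,\dots,a_{n-1})$, $|\mathbf a|_1=a_1a_2\cdots a_n$. Write points of $\mathbb R^n$ as $x=(x',x_n)$ with $x'\in\mathbb R^{n-1}$. Let $f\in C^\infty(\mathbb R^n)$ (complex-valued) be even in $x_n$, with compact support contained in $\mathbb R^{n-1}\times(\mathbb R\setminus\{0\})$. The elliptical Radon transform of $f$ is $$R_{E,A}f(u,t)=\int_{\mathbb R^n} f(x)\,\delta\big(|A^{-1}(x-(u,0))|-t\big)\,dx=\lim_{\varepsilon\to0^+}\frac1{2\varepsilon}\int_{\{x:\ |\,|A^{-1}(x-(u,0))|-t\,|<\varepsilon\}}f(x)\,dx,\qquad (u,t)\in\mathbb R^{n-1}\times[0,\infty),$$ and for a function $h$ on $(0,\infty)$ put $$\Lambda_t h(t)=\int_{\mathbb R}\int_0^\infty e^{i(t^2-\tau^2)\beta}\,|\beta|^{n-1}h(\tau)\,d\tau\,d\beta .$$ Then the limit defining $R_{E,A}f(u,t)$ exists for all $(u,t)\in\mathbb R^{n-1}\times[0,\infty)$,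 and for every $x=(x',x_n)\in\mathbb R^n$ $$f(x)=\frac{|x_n|}{2\pi^{n}|\mathbf a|_1^2}\int_{\mathbb R^{n-1}}\Lambda_t(R_{E,A}f)(\alpha,t)\Big|_{t=\sqrt{|\bar A^{-1}(\alpha-x')|^2+a_n^{-2}x_n^2}}\;d\alpha ,$$ where each of the successive integrals (over $\tau$, then $\beta$, then $\alpha$) converges absolutely. For $n=2$ one has moreover, for every $x=(x_1,x_2)\in\mathbb R^2$, $$f(x)=-\frac{|x_2|}{\pi^2a_1^2a_2^2}\int_{\mathbb R}\left(\mathrm{f.p.}\!\int_0^\infty\frac{R_{E,A}f(\alpha,t)}{\big(|a_1^{-1}(\alpha-x_1)|^2+a_2^{-2}x_2^2-t^2\big)^2}\,dt\right)d\alpha ,$$ where the inner integral is understood in the sense of distributions, that is, as the Hadamard finite part: with $c=|a_1^{-1}(\alpha-x_1)|^2+a_2^{-2}x_2^2$, it is the limit as $\varepsilon\to0^+$ of the integral over $\{t>0:\ |c-t^2|>\varepsilon\}$ minus the divergent term $C/\varepsilon$, $C$ being the unique constant for which that limit exists. These finite parts exist for all $\alpha\in\mathbb R$ and the outer integral converges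 absolutely. -/

import Mathlib

open MeasureTheory Filter Topology
open scoped ContDiff

namespace EllipticalRadon

noncomputable section

/-- The point `(x', s)` of `ℝ^d × ℝ = ℝ^(d+1)`. -/
def point {d : ℕ} (x' : EuclideanSpace ℝ (Fin d)) (s : ℝ) : EuclideanSpace ℝ (Fin (d + 1)) :=
  WithLp.toLp 2 (Fin.snoc (α := fun _ => ℝ) (fun i => x' i) s)

/-- `A⁻¹ x` for the diagonal matrix `A = diag(a_1, ..., a_m)`. -/
def diagInv {m : ℕ} (a : Fin m → ℝ) (x : EuclideanSpace ℝ (Fin m)) : EuclideanSpace ℝ (Fin m) :=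
  WithLp.toLp 2 (fun i => (a i)⁻¹ * x i)

/-- Smooth functions on `ℝ^d × ℝ`, even in the last variable, with compact support in
`ℝ^d × (ℝ ∖ {0})`. -/
structure Admissible {d : ℕ} (f : EuclideanSpace ℝ (Fin (d + 1)) → ℂ) : Prop where
  smooth : ContDiff ℝ ∞ f
  compactSupport : HasCompactSupport f
  support_subset : tsupport f ⊆ {x | x (Fin.last d) ≠ 0}
  even : ∀ (x' : EuclideanSpace ℝ (Fin d)) (s : ℝ), f (point x' (-s)) = f (point x' s)

/-- `∫ f(x) δ(φ(x) - t) dx = L`, where `δ` is the limit of the normalized indicator functions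
`(2ε)⁻¹ 1_{(-ε, ε)}` as `ε → 0+`. -/
def HasDeltaIntegral {E : Type*} [MeasureSpace E] (φ : E → ℝ) (t : ℝ) (f : E → ℂ) (L : ℂ) : Prop :=
  Tendsto (fun ε : ℝ => (2 * ε)⁻¹ • ∫ x in {x | |φ x - t| < ε}, f x) (𝓝[>] 0) (𝓝 L)

/-- `∫ f(x) δ(φ(x) - t) dx`, as the value of the limit in `HasDeltaIntegral`. -/
def deltaIntegral {E : Type*} [MeasureSpace E] (φ : E → ℝ) (t : ℝ) (f : E → ℂ) : ℂ :=
  limUnder (𝓝[>] (0 : ℝ)) (fun ε : ℝ => (2 * ε)⁻¹ • ∫ x in {x | |φ x - t| < ε}, f x)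

/-- `x ↦ |A⁻¹ (x - (u, 0))|`; its level sets are the ellipsoids of integration. -/
def ellipsoidalRadius {d : ℕ} (a : Fin (d + 1) → ℝ) (u : EuclideanSpace ℝ (Fin d))
    (x : EuclideanSpace ℝ (Fin (d + 1))) : ℝ :=
  ‖diagInv a (x - point u 0)‖

/-- The elliptical Radon transform `∫ f(x) δ(|A⁻¹ (x - (u, 0))| - t) dx`. -/
def ellipticalRadon {d : ℕ} (a : Fin (d + 1) → ℝ) (f : EuclideanSpace ℝ (Fin (d + 1)) → ℂ)
    (u : EuclideanSpace ℝ (Fin d)) (t : ℝ) : ℂ :=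
  deltaIntegral (ellipsoidalRadius a u) t f

/-- `t = √(|Ā⁻¹ (α - x')|² + a_n⁻² x_n²)` with `Ā = diag(a_1, ..., a_{n-1})`. -/
def evalTime {d : ℕ} (a : Fin (d + 1) → ℝ) (x' : EuclideanSpace ℝ (Fin d)) (xn : ℝ)
    (α : EuclideanSpace ℝ (Fin d)) : ℝ :=
  Real.sqrt (‖diagInv (fun i : Fin d => a i.castSucc) (α - x')‖ ^ 2
    + ((a (Fin.last d)) ^ 2)⁻¹ * xn ^ 2)

/-- The integrand `e^{i (t² - τ²) β} |β|^{n-1} h(τ)` of `Λ`. -/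
def LambdaIntegrand (n : ℕ) (h : ℝ → ℂ) (t β τ : ℝ) : ℂ :=
  Complex.exp (Complex.I * (((t ^ 2 - τ ^ 2) * β : ℝ) : ℂ)) * ((|β| ^ (n - 1) : ℝ) : ℂ) * h τ

/-- `Λ h (t) = ∫_ℝ ∫_0^∞ e^{i (t² - τ²) β} |β|^{n-1} h(τ) dτ dβ`. -/
def Lambda (n : ℕ) (h : ℝ → ℂ) (t : ℝ) : ℂ :=
  ∫ β : ℝ, ∫ τ in Set.Ioi (0 : ℝ), LambdaIntegrand n h t β τ

/-- Both integrals of the iterated integral `Lambda n h t` converge absolutely. -/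
def LambdaConverges (n : ℕ) (h : ℝ → ℂ) (t : ℝ) : Prop :=
  (∀ β : ℝ, IntegrableOn (fun τ => LambdaIntegrand n h t β τ) (Set.Ioi 0)) ∧
    Integrable (fun β : ℝ => ∫ τ in Set.Ioi (0 : ℝ), LambdaIntegrand n h t β τ)

/-- `L` is the Hadamard finite part of `∫_0^∞ h(t) / (c - t²)² dt`: cut out the part where
`|c - t²| ≤ ε`, discard the divergent term `C / ε` and let `ε → 0+`. (The constant `C`, and hence
`L`, is determined by `h` and `c`.) This is the value on `h` of the distribution `x⁻²` composed
with `x = c - t²`. -/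
def HasFinitePart (h : ℝ → ℂ) (c : ℝ) (L : ℂ) : Prop :=
  (∀ ε : ℝ, 0 < ε →
      IntegrableOn (fun t : ℝ => h t / (((c - t ^ 2) ^ 2 : ℝ) : ℂ)) {t | 0 < t ∧ ε < |c - t ^ 2|}) ∧
    ∃ C : ℂ, Tendsto
      (fun ε : ℝ => (∫ t in {t : ℝ | 0 < t ∧ ε < |c - t ^ 2|}, h t / (((c - t ^ 2) ^ 2 : ℝ) : ℂ))
        - C / (ε : ℂ))
      (𝓝[>] 0) (𝓝 L)

end

end EllipticalRadon

open EllipticalRadon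

/-! The scaling `A⁻¹` turns the ellipsoids into spheres centred on the hyperplane `x_n = 0`, and the
substitution `v = x_n²` turns the spheres `|y - α|² + x_n² = s` into translates `v = s - |y - α|²`
of one paraboloid. Evenness, and the vanishing of `f` near `x_n = 0`, make the transported function
`G` (`scaledProfile`) smooth with compact support. Then `R f(u, t)` is `|a|₁ · 2t · ρ(t²)`, where
`ρ` integrates `G` over the paraboloid with parameters `α = Ā⁻¹u` and `s = t²`
(`hasDeltaIntegral_ellipsoidalRadius`).

A shear straightens the quadratic part: the Fourier transform of `ρ` in `s` is, up to a phase, that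
of `H(y, s) = G(y, s - |y|²)` at the frequency `(-2bα, b)` (`fourier_paraboloidIntegral`). The
weight `|b|^(n-1)` in `Λ` is, up to a constant, the Jacobian of `α ↦ -2bα`, so integrating over `β`
and `α` is Fourier inversion for the Schwartz function `H` (`integrable_integral_backprojection`).

For `n = 2` the multiplier `|b|` is a constant multiple of the Fourier transform of the finite part
of `s⁻²` (`tendsto_finitePart`), which follows from `∫₀^∞ (1 - cos βu)/u² du = π|β|/2`. The finite
part therefore equals `-Λ/2` for each `α`, and the kernel formula follows from the general one. -/

namespace EllipticalRadon

noncomputable section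

/-! ### Inversion of integrals over translated paraboloids by the Fourier transform. -/

section Paraboloid

open scoped FourierTransform RealInnerProductSpace

variable {E : Type*} [NormedAddCommGroup E] [InnerProductSpace ℝ E]

/-- The shear `(y, s) ↦ (y, s - |y - α|²)`. -/
def paraboloidShear (α : E) : E × ℝ ≃ₜ E × ℝ where
  toFun p := (p.1, p.2 - ‖p.1 - α‖ ^ 2)
  invFun p := (p.1, p.2 + ‖p.1 - α‖ ^ 2)
  left_inv p := by simp
  right_inv p := by simp
  continuous_toFun := by fun_prop
  continuous_invFun := by fun_prop

/-- The function `(y, s) ↦ G (y, s - |y|²)`, on the Euclidean product. -/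
def paraboloidLift (G : E × ℝ → ℂ) (w : WithLp 2 (E × ℝ)) : ℂ :=
  G (w.fst, w.snd - ‖w.fst‖ ^ 2)

lemma contDiff_paraboloidLift {G : E × ℝ → ℂ} (hG : ContDiff ℝ ∞ G) :
    ContDiff ℝ ∞ (paraboloidLift G) := by
  have h1 : ContDiff ℝ ∞ (fun w : WithLp 2 (E × ℝ) => w.fst) :=
    contDiff_fst.comp (WithLp.prodContinuousLinearEquiv 2 ℝ E ℝ).contDiff
  have h2 : ContDiff ℝ ∞ (fun w : WithLp 2 (E × ℝ) => w.snd) :=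
    contDiff_snd.comp (WithLp.prodContinuousLinearEquiv 2 ℝ E ℝ).contDiff
  exact hG.comp (h1.prodMk (h2.sub (h1.norm_sq ℝ)))

lemma hasCompactSupport_paraboloidLift {G : E × ℝ → ℂ} (hc : HasCompactSupport G) :
    HasCompactSupport (paraboloidLift G) := by
  have := hc.comp_homeomorph
    ((WithLp.prodContinuousLinearEquiv 2 ℝ E ℝ).toHomeomorph.trans (paraboloidShear (0 : E)))
  convert this using 1
  ext w
  simp [paraboloidLift, paraboloidShear]

variable [FiniteDimensional ℝ E] [MeasurableSpace E] [BorelSpace E]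

/-- The integral of `G` over the translated paraboloid `{(y, s - |y - α|²)}`, with respect to `dy`. -/
def paraboloidIntegral (G : E × ℝ → ℂ) (α : E) (s : ℝ) : ℂ :=
  ∫ y, G (y, s - ‖y - α‖ ^ 2)

lemma integrable_comp_shear {G : E × ℝ → ℂ} (hG : Continuous G) (hc : HasCompactSupport G) (α : E) :
    Integrable (fun p : E × ℝ => G (p.1, p.2 - ‖p.1 - α‖ ^ 2)) (volume.prod volume) :=
  (hG.comp (paraboloidShear α).continuous).integrable_of_hasCompactSupport
    (hc.comp_homeomorph (paraboloidShear α))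

lemma continuous_paraboloidIntegral {G : E × ℝ → ℂ} (hG : Continuous G) (hc : HasCompactSupport G)
    (α : E) : Continuous (paraboloidIntegral G α) := by
  -- Only `y` in the projection of the support contributes, whatever `s` is, so the integral is over
  -- a fixed compact set.
  have hK : IsCompact (Prod.fst '' tsupport G) := hc.image continuous_fst
  have h := continuous_parametric_integral_of_continuous (μ := (volume : Measure E))
    (f := fun (s : ℝ) (y : E) => G (y, s - ‖y - α‖ ^ 2))
    (by unfold Function.uncurry; fun_prop) hK
  convert h using 2 with s
  rw [paraboloidIntegral, setIntegral_eq_integral_of_forall_compl_eq_zero]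
  intro y hy
  by_contra h0
  exact hy ⟨_, subset_tsupport G h0, rfl⟩

lemma integrable_paraboloidIntegral {G : E × ℝ → ℂ} (hG : Continuous G) (hc : HasCompactSupport G)
    (α : E) : Integrable (paraboloidIntegral G α) :=
  (integrable_comp_shear hG hc α).integral_prod_right

/-- Fubini and a translation in `s`. The weight is only bounded and measurable, so that both
exponentials and indicators of radial windows are covered. -/
lemma integral_mul_paraboloidIntegral {G : E × ℝ → ℂ} (hG : Continuous G)
    (hc : HasCompactSupport G) (α : E) {k : ℝ → ℂ} (hk : Measurable k) {M : ℝ}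
    (hM : ∀ s, ‖k s‖ ≤ M) :
    ∫ s, k s * paraboloidIntegral G α s = ∫ y, ∫ v, k (v + ‖y - α‖ ^ 2) * G (y, v) := by
  have hint : Integrable (fun p : E × ℝ => k p.2 * G (p.1, p.2 - ‖p.1 - α‖ ^ 2))
      (volume.prod volume) :=
    (integrable_comp_shear hG hc α).bdd_mul (hk.comp measurable_snd).aestronglyMeasurable
      (Eventually.of_forall fun p => hM p.2)
  calc ∫ s, k s * paraboloidIntegral G α s
      = ∫ s, ∫ y, k s * G (y, s - ‖y - α‖ ^ 2) := by
        simp_rw [paraboloidIntegral, integral_const_mul]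
    _ = ∫ y, ∫ s, k s * G (y, s - ‖y - α‖ ^ 2) := (integral_integral_swap hint).symm
    _ = _ := by
        congr 1 with y
        rw [← integral_add_right_eq_self (fun s => k s * G (y, s - ‖y - α‖ ^ 2)) (‖y - α‖ ^ 2)]
        simp

lemma fourier_paraboloidLift {G : E × ℝ → ℂ} (hG : Continuous G)
    (hc : HasCompactSupport G) (η : E) (b : ℝ) :
    𝓕 (paraboloidLift G) (WithLp.toLp 2 (η, b)) = ∫ y, ∫ v,
      Complex.exp (((-2 * Real.pi * (⟪y, η⟫ + (v + ‖y‖ ^ 2) * b) : ℝ) : ℂ) * Complex.I) * G (y, v) := by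
  have hint : Integrable (fun p : E × ℝ =>
      Complex.exp (((-2 * Real.pi * (⟪p.1, η⟫ + p.2 * b) : ℝ) : ℂ) * Complex.I) * G (p.1, p.2 - ‖p.1‖ ^ 2))
      (volume.prod volume) := by
    have h := integrable_comp_shear hG hc 0
    simp only [sub_zero] at h
    refine h.bdd_mul (c := 1) ?_ (Eventually.of_forall fun p => ?_)
    · exact Continuous.aestronglyMeasurable (by fun_prop)
    · rw [Complex.norm_exp_ofReal_mul_I]
  rw [Real.fourier_eq', ← (WithLp.volume_preserving_toLp E ℝ).integral_comp
    (MeasurableEquiv.toLp 2 (E × ℝ)).measurableEmbedding]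
  calc _ = ∫ p : E × ℝ, Complex.exp (((-2 * Real.pi * (⟪p.1, η⟫ + p.2 * b) : ℝ) : ℂ) * Complex.I)
        * G (p.1, p.2 - ‖p.1‖ ^ 2) := by
        congr 1 with p
        simp [paraboloidLift, WithLp.prod_inner_apply, mul_comm]
    _ = _ := by
        rw [Measure.volume_eq_prod, integral_prod _ hint]
        congr 1 with y
        rw [← integral_add_right_eq_self _ (‖y‖ ^ 2)]
        simp

/-- In `|y - α|² = |y|² - 2⟪y, α⟫ + |α|²`, the first term is absorbed by the lift, the second shifts
the frequency to `-2bα`, and the third is a phase. -/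
lemma fourier_paraboloidIntegral {G : E × ℝ → ℂ} (hG : Continuous G)
    (hc : HasCompactSupport G) (α : E) (b : ℝ) :
    𝓕 (paraboloidIntegral G α) b
      = Complex.exp (((-2 * Real.pi * ‖α‖ ^ 2 * b : ℝ) : ℂ) * Complex.I)
        * 𝓕 (paraboloidLift G) (WithLp.toLp 2 ((-2 * b) • α, b)) := by
  rw [Real.fourier_real_eq_integral_exp_smul, fourier_paraboloidLift hG hc]
  simp_rw [smul_eq_mul]
  rw [integral_mul_paraboloidIntegral hG hc α (M := 1)
    (k := fun v => Complex.exp (((-2 * Real.pi * v * b : ℝ) : ℂ) * Complex.I)) (by fun_prop)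
    (fun s => by rw [Complex.norm_exp_ofReal_mul_I]), ← integral_const_mul]
  congr 1 with y
  rw [← integral_const_mul]
  congr 1 with v
  rw [← mul_assoc, ← Complex.exp_add, ← add_mul, ← Complex.ofReal_add]
  congr 4
  rw [norm_sub_sq_real, real_inner_smul_right]
  ring

lemma exists_schwartz_paraboloid {G : E × ℝ → ℂ} (hG : ContDiff ℝ ∞ G)
    (hc : HasCompactSupport G) :
    ∃ F : SchwartzMap (WithLp 2 (E × ℝ)) ℂ, ⇑F = 𝓕 (paraboloidLift G) :=
  ⟨𝓕 ((hasCompactSupport_paraboloidLift hc).toSchwartzMap (contDiff_paraboloidLift hG)), rfl⟩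

lemma continuous_fourier_paraboloidLift {G : E × ℝ → ℂ} (hG : ContDiff ℝ ∞ G)
    (hc : HasCompactSupport G) : Continuous (𝓕 (paraboloidLift G)) := by
  obtain ⟨F, hF⟩ := exists_schwartz_paraboloid hG hc
  rw [← hF]
  exact F.continuous

/-- The frequency `(-2bα, b)` has norm at least `|b|` for every `α`. Schwartz decay of order `k + 2`
thus absorbs `|b|^k` and leaves an integrable power in `b`. -/
lemma norm_fourier_paraboloidIntegral_le {G : E × ℝ → ℂ} (hG : ContDiff ℝ ∞ G)
    (hc : HasCompactSupport G) (k : ℕ) :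
    ∃ C : ℝ, ∀ α b, |b| ^ k * ‖𝓕 (paraboloidIntegral G α) b‖ ≤ C * (1 + ‖b‖) ^ (-(2 : ℝ)) := by
  obtain ⟨F, hF⟩ := exists_schwartz_paraboloid hG hc
  refine ⟨2 ^ (k + 2) * (Finset.Iic (k + 2, 0)).sup
    (fun m => SchwartzMap.seminorm ℝ m.1 m.2) F, fun α b => ?_⟩
  have h := SchwartzMap.one_add_le_sup_seminorm_apply (𝕜 := ℝ) (m := (k + 2, 0)) (k := k + 2)
    (n := 0) le_rfl le_rfl F (WithLp.toLp 2 ((-2 * b) • α, b))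
  rw [norm_iteratedFDeriv_zero] at h
  rw [fourier_paraboloidIntegral hG.continuous hc, norm_mul, Complex.norm_exp_ofReal_mul_I,
    one_mul, ← hF, Real.rpow_neg (by positivity), ← div_eq_mul_inv, le_div_iff₀ (by positivity)]
  refine le_trans ?_ h
  have hb : ‖b‖ ≤ ‖(WithLp.toLp 2 ((-2 * b) • α, b) : WithLp 2 (E × ℝ))‖ :=
    WithLp.norm_snd_le E (WithLp.toLp 2 ((-2 * b) • α, b))
  set w : WithLp 2 (E × ℝ) := WithLp.toLp 2 ((-2 * b) • α, b)
  have h1 : |b| ^ k ≤ (1 + ‖w‖) ^ k := by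
    gcongr
    rw [Real.norm_eq_abs] at hb
    linarith
  have h2 : (1 + ‖b‖) ^ (2 : ℝ) ≤ (1 + ‖w‖) ^ 2 := by
    rw [Real.rpow_two]
    gcongr
  calc _ ≤ (1 + ‖w‖) ^ k * ‖F w‖ * (1 + ‖w‖) ^ 2 := by gcongr
    _ = _ := by ring

lemma continuous_fourier_paraboloidIntegral {G : E × ℝ → ℂ} (hG : ContDiff ℝ ∞ G)
    (hc : HasCompactSupport G) :
    Continuous (fun p : E × ℝ => 𝓕 (paraboloidIntegral G p.1) p.2) := by
  simp_rw [fourier_paraboloidIntegral hG.continuous hc]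
  refine Continuous.mul ?_ ((continuous_fourier_paraboloidLift hG hc).comp ?_)
  · fun_prop
  exact (WithLp.prod_continuous_toLp 2 E ℝ).comp (by fun_prop)

lemma integrable_pow_mul_fourier_paraboloidIntegral {G : E × ℝ → ℂ} (hG : ContDiff ℝ ∞ G)
    (hc : HasCompactSupport G) (k : ℕ) (α : E) :
    Integrable (fun b : ℝ => ((|b| ^ k : ℝ) : ℂ) * 𝓕 (paraboloidIntegral G α) b) := by
  obtain ⟨C, hC⟩ := norm_fourier_paraboloidIntegral_le hG hc k
  have h1 : Integrable (fun b : ℝ => C * (1 + ‖b‖) ^ (-(2 : ℝ))) :=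
    (integrable_one_add_norm (by simp)).const_mul C
  refine h1.mono' ?_ (Eventually.of_forall fun b => ?_)
  · have := (continuous_fourier_paraboloidIntegral hG hc).comp (Continuous.prodMk_right α)
    exact Continuous.aestronglyMeasurable (Continuous.mul (by fun_prop) this)
  · rw [norm_mul, Complex.norm_real, Real.norm_eq_abs, abs_of_nonneg (by positivity)]
    exact hC α b

/-- For fixed `b ≠ 0`, the substitution `η = -2bα` has Jacobian `|2b|^d`; the weight cancels `|b|^d`
and the factor `2^(-d)` remains. The slice `b = 0`, where the substitution degenerates, is null. -/
lemma integrable_integral_scale {Φ : E × ℝ → ℂ} (hΦ : Continuous Φ)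
    (hi : Integrable Φ (volume.prod volume)) :
    Integrable (fun z : E × ℝ => ((|z.2| ^ Module.finrank ℝ E : ℝ) : ℂ) * Φ ((-2 * z.2) • z.1, z.2))
      (volume.prod volume) ∧
    ∫ z : E × ℝ, ((|z.2| ^ Module.finrank ℝ E : ℝ) : ℂ) * Φ ((-2 * z.2) • z.1, z.2)
        ∂(volume.prod volume)
      = ((2 ^ Module.finrank ℝ E : ℝ) : ℂ)⁻¹ * ∫ z, Φ z ∂(volume.prod volume) := by
  set d := Module.finrank ℝ E
  have hscal : ∀ b : ℝ, b ≠ 0 → |b| ^ d * |((-2 * b) ^ d)⁻¹| = (2 ^ d)⁻¹ := by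
    intro b hb
    have : |b| ≠ 0 := abs_ne_zero.2 hb
    rw [abs_inv, abs_pow, abs_mul, abs_neg, abs_two, mul_pow]
    field_simp
  have hne : ∀ᵐ b : ℝ, b ≠ 0 := Measure.ae_ne volume 0
  have hint : Integrable
      (fun z : E × ℝ => ((|z.2| ^ d : ℝ) : ℂ) * Φ ((-2 * z.2) • z.1, z.2)) (volume.prod volume) := by
    rw [integrable_prod_iff' (Continuous.aestronglyMeasurable (by fun_prop))]
    constructor
    · filter_upwards [hi.prod_left_ae, hne] with b hb hb0
      exact (hb.comp_smul (R := -2 * b) (by simpa using hb0)).const_mul _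
    · have h2 : Integrable (fun b : ℝ => ((2 : ℝ) ^ d)⁻¹ * ∫ y, ‖Φ (y, b)‖) :=
        hi.norm.integral_prod_right.const_mul _
      refine h2.congr ?_
      filter_upwards [hne] with b hb0
      simp_rw [norm_mul, Complex.norm_real, norm_pow, Real.norm_eq_abs, abs_abs]
      rw [integral_const_mul, Measure.integral_comp_smul volume (fun y => ‖Φ (y, b)‖) (-2 * b),
        smul_eq_mul, ← mul_assoc, hscal b hb0]
  refine ⟨hint, ?_⟩
  rw [integral_prod_symm _ hint, integral_prod_symm _ hi, ← integral_const_mul]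
  refine integral_congr_ae ?_
  filter_upwards [hne] with b hb0
  rw [integral_const_mul, Measure.integral_comp_smul volume (fun y => Φ (y, b)) (-2 * b),
    Complex.real_smul, ← mul_assoc, ← Complex.ofReal_mul, hscal b hb0, Complex.ofReal_inv]

/-- The integrand of the reconstruction of `G (p, q)` from its integrals over paraboloids. -/
def backprojectionIntegrand (G : E × ℝ → ℂ) (p : E) (q : ℝ) (α : E) (b : ℝ) : ℂ :=
  ((|b| ^ Module.finrank ℝ E : ℝ) : ℂ) *
    (Complex.exp (((2 * Real.pi * (‖α - p‖ ^ 2 + q) * b : ℝ) : ℂ) * Complex.I)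
      * 𝓕 (paraboloidIntegral G α) b)

lemma integrable_backprojectionIntegrand {G : E × ℝ → ℂ} (hG : ContDiff ℝ ∞ G)
    (hc : HasCompactSupport G) (p : E) (q : ℝ) (α : E) :
    Integrable (backprojectionIntegrand G p q α) := by
  have h := (integrable_pow_mul_fourier_paraboloidIntegral hG hc (Module.finrank ℝ E) α).bdd_mul
    (c := 1)
    (f := fun b : ℝ =>
      Complex.exp (((2 * Real.pi * (‖α - p‖ ^ 2 + q) * b : ℝ) : ℂ) * Complex.I))
    (Continuous.aestronglyMeasurable (by fun_prop))
    (Eventually.of_forall fun b => by rw [Complex.norm_exp_ofReal_mul_I])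
  refine h.congr (Eventually.of_forall fun b => ?_)
  simp only [backprojectionIntegrand]
  ring

/-- After the substitution `η = -2bα` this is Fourier inversion for the lift at `(p, |p|² + q)`,
where the lift takes the value `G (p, q)`. Joint integrability in `(α, b)` gives the convergence of
the outer integral. -/
lemma integrable_integral_backprojection {G : E × ℝ → ℂ} (hG : ContDiff ℝ ∞ G)
    (hc : HasCompactSupport G) (p : E) (q : ℝ) :
    Integrable (fun α => ∫ b, backprojectionIntegrand G p q α b) ∧
    ∫ α, ∫ b, backprojectionIntegrand G p q α b
      = ((2 ^ Module.finrank ℝ E : ℝ) : ℂ)⁻¹ * G (p, q) := by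
  obtain ⟨F, hF⟩ := exists_schwartz_paraboloid hG hc
  set w : WithLp 2 (E × ℝ) := WithLp.toLp 2 (p, ‖p‖ ^ 2 + q)
  set Φ : E × ℝ → ℂ := fun z =>
    Complex.exp (((2 * Real.pi * ⟪(WithLp.toLp 2 z : WithLp 2 (E × ℝ)), w⟫ : ℝ) : ℂ) * Complex.I)
      • 𝓕 (paraboloidLift G) (WithLp.toLp 2 z) with hΦdef
  have hcont : Continuous Φ := by
    have h1 := WithLp.prod_continuous_toLp 2 E ℝ
    have h2 := (continuous_fourier_paraboloidLift hG hc).comp h1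
    have h3 : Continuous fun z : E × ℝ => ⟪(WithLp.toLp 2 z : WithLp 2 (E × ℝ)), w⟫ :=
      h1.inner continuous_const
    have h4 : Continuous fun z : E × ℝ => Complex.exp
        (((2 * Real.pi * ⟪(WithLp.toLp 2 z : WithLp 2 (E × ℝ)), w⟫ : ℝ) : ℂ) * Complex.I) := by
      fun_prop
    exact h4.smul h2
  have hFint : Integrable (𝓕 (paraboloidLift G)) := hF ▸ F.integrable
  have hmp := WithLp.volume_preserving_toLp E ℝ
  have hemb : MeasurableEmbedding (@WithLp.toLp 2 (E × ℝ)) :=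
    (MeasurableEquiv.toLp 2 (E × ℝ)).measurableEmbedding
  have hΦint : Integrable Φ (volume.prod volume) := by
    have h1 : Integrable (fun z : E × ℝ => 𝓕 (paraboloidLift G) (WithLp.toLp 2 z))
      (volume.prod volume) := (hmp.integrable_comp_emb hemb).2 hFint
    refine h1.mono hcont.aestronglyMeasurable (Eventually.of_forall fun z => ?_)
    rw [hΦdef]
    simp only [norm_smul, Complex.norm_exp_ofReal_mul_I, one_mul, le_refl]
  have hΦval : ∫ z, Φ z ∂(volume.prod volume) = G (p, q) := by
    have h1 := hmp.integral_comp hemb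
      (fun v => Complex.exp (((2 * Real.pi * ⟪v, w⟫ : ℝ) : ℂ) * Complex.I)
        • 𝓕 (paraboloidLift G) v)
    rw [← Real.fourierInv_eq', Continuous.fourierInv_fourier_eq
      (contDiff_paraboloidLift hG).continuous
      ((contDiff_paraboloidLift hG).continuous.integrable_of_hasCompactSupport
        (hasCompactSupport_paraboloidLift hc)) hFint] at h1
    rw [← Measure.volume_eq_prod, hΦdef, h1]
    simp [paraboloidLift, w]
  -- The phases match because `⟪(-2bα, b), (p, |p|² + q)⟫ = b(|α - p|² + q) - b|α|²`.
  have hkey : ∀ z : E × ℝ, ((|z.2| ^ Module.finrank ℝ E : ℝ) : ℂ) * Φ ((-2 * z.2) • z.1, z.2)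
      = backprojectionIntegrand G p q z.1 z.2 := by
    rintro ⟨α, b⟩
    simp only [backprojectionIntegrand, hΦdef, fourier_paraboloidIntegral hG.continuous hc,
      smul_eq_mul]
    rw [← mul_assoc (Complex.exp _) (Complex.exp _), ← Complex.exp_add, ← add_mul,
      ← Complex.ofReal_add]
    congr 5
    simp only [w, WithLp.prod_inner_apply, norm_sub_sq_real, real_inner_smul_left,
      RCLike.inner_apply, conj_trivial]
    ring
  obtain ⟨h1, h2⟩ := integrable_integral_scale hcont hΦint
  simp_rw [hkey] at h1 h2
  refine ⟨h1.integral_prod_left, ?_⟩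
  rw [← hΦval, ← h2, integral_prod _ h1]

end Paraboloid

/-! ### The multiplier `|b|` as a Hadamard finite part. -/

section FinitePart

open scoped FourierTransform
open Set

lemma integral_mul_exp_neg_mul_Ioi {u : ℝ} (hu : 0 < u) :
    IntegrableOn (fun y : ℝ => y * Real.exp (-(u * y))) (Ioi 0) ∧
      ∫ y in Ioi (0 : ℝ), y * Real.exp (-(u * y)) = (u ^ 2)⁻¹ := by
  -- The antiderivative is `-(uy + 1)e^(-uy)/u²`; the exponents `1` and `0` are kept so that the
  -- limit at infinity is two cases of `Real.tendsto_pow_mul_exp_neg_atTop_nhds_zero`.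
  have hd : ∀ y ∈ Ici (0 : ℝ), HasDerivAt
      (fun y : ℝ => -((u * y) ^ 1 * Real.exp (-(u * y)) + (u * y) ^ 0 * Real.exp (-(u * y)))
        * (u ^ 2)⁻¹)
      (y * Real.exp (-(u * y))) y := by
    intro y _
    have h1 : HasDerivAt (fun y : ℝ => u * y) u y := by simpa using (hasDerivAt_id y).const_mul u
    have h2 := h1.neg.exp
    refine (((((h1.pow 1).mul h2).add ((h1.pow 0).mul h2)).neg).mul_const (u ^ 2)⁻¹).congr_deriv ?_
    simp
    field_simp
    ring
  have hl : Tendsto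
      (fun y : ℝ => -((u * y) ^ 1 * Real.exp (-(u * y)) + (u * y) ^ 0 * Real.exp (-(u * y)))
        * (u ^ 2)⁻¹) atTop (𝓝 0) := by
    have h0 : Tendsto (fun y : ℝ => u * y) atTop atTop := tendsto_id.const_mul_atTop hu
    have h1 := (Real.tendsto_pow_mul_exp_neg_atTop_nhds_zero 1).comp h0
    have h2 := (Real.tendsto_pow_mul_exp_neg_atTop_nhds_zero 0).comp h0
    simpa using ((h1.add h2).neg).mul_const (u ^ 2)⁻¹
  have hp : ∀ y ∈ Ioi (0 : ℝ), 0 ≤ y * Real.exp (-(u * y)) := fun y hy =>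
    mul_nonneg (le_of_lt hy) (Real.exp_pos _).le
  refine ⟨integrableOn_Ioi_deriv_of_nonneg' hd hp hl, ?_⟩
  rw [integral_Ioi_of_hasDerivAt_of_nonneg' hd hp hl]
  simp

lemma integral_exp_neg_mul_one_sub_cos_Ioi {y : ℝ} (hy : 0 < y) :
    IntegrableOn (fun u : ℝ => y * Real.exp (-(u * y)) * (1 - Real.cos u)) (Ioi 0) ∧
      ∫ u in Ioi (0 : ℝ), y * Real.exp (-(u * y)) * (1 - Real.cos u) = (1 + y ^ 2)⁻¹ := by
  have hd : ∀ u ∈ Ici (0 : ℝ), HasDerivAt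
      (fun u : ℝ => Real.exp (-(u * y)) *
        (-1 + y * (y * Real.cos u - Real.sin u) * (1 + y ^ 2)⁻¹))
      (y * Real.exp (-(u * y)) * (1 - Real.cos u)) u := by
    intro u _
    have h1 : HasDerivAt (fun u : ℝ => u * y) y u := by simpa using (hasDerivAt_id u).mul_const y
    have h2 := h1.neg.exp
    have h3 := (((((Real.hasDerivAt_cos u).const_mul y).sub (Real.hasDerivAt_sin u)).const_mul
      y).mul_const (1 + y ^ 2)⁻¹).const_add (-1)
    refine (h2.mul h3).congr_deriv ?_
    have : (1 + y ^ 2) ≠ 0 := by positivity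
    simp only [Pi.neg_apply, Pi.sub_apply]
    field_simp
    ring
  have hl : Tendsto (fun u : ℝ => Real.exp (-(u * y)) *
        (-1 + y * (y * Real.cos u - Real.sin u) * (1 + y ^ 2)⁻¹)) atTop (𝓝 0) := by
    have h0 : Tendsto (fun u : ℝ => Real.exp (-(u * y))) atTop (𝓝 0) :=
      Real.tendsto_exp_neg_atTop_nhds_zero.comp (tendsto_id.atTop_mul_const hy)
    refine h0.zero_mul_isBoundedUnder_le ?_
    refine isBoundedUnder_of ⟨1 + y * (y * 1 + 1) * (1 + y ^ 2)⁻¹, fun u => ?_⟩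
    have hc := Real.abs_cos_le_one u
    have hs := Real.abs_sin_le_one u
    simp only [Function.comp, Real.norm_eq_abs]
    refine (abs_add_le _ _).trans ?_
    rw [abs_neg, abs_one, abs_mul, abs_mul, abs_of_pos hy,
      abs_of_pos (show 0 < (1 + y ^ 2)⁻¹ by positivity)]
    gcongr
    refine (abs_sub _ _).trans ?_
    rw [abs_mul, abs_of_pos hy]
    gcongr
  have hp : ∀ u ∈ Ioi (0 : ℝ), 0 ≤ y * Real.exp (-(u * y)) * (1 - Real.cos u) := fun u _ =>
    mul_nonneg (mul_nonneg hy.le (Real.exp_pos _).le) (sub_nonneg.2 (Real.cos_le_one u))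
  refine ⟨integrableOn_Ioi_deriv_of_nonneg' hd hp hl, ?_⟩
  rw [integral_Ioi_of_hasDerivAt_of_nonneg' hd hp hl]
  have : (1 + y ^ 2) ≠ 0 := by positivity
  simp
  field_simp
  ring

/-- Write `u⁻² = ∫₀^∞ y e^(-uy) dy` and exchange the integrals; the inner integral becomes `1/(1 +
y²)`. By Tonelli no prior integrability is needed, and the integrability of the original function is
read off from the finite value. -/
lemma lintegral_one_sub_cos_div_sq :
    ∫⁻ u in Ioi (0 : ℝ), ENNReal.ofReal ((1 - Real.cos u) / u ^ 2)
      = ENNReal.ofReal (Real.pi / 2) := by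
  have h1 : ∀ u ∈ Ioi (0 : ℝ), ENNReal.ofReal ((1 - Real.cos u) / u ^ 2)
      = ∫⁻ y in Ioi (0 : ℝ), ENNReal.ofReal (y * Real.exp (-(u * y)) * (1 - Real.cos u)) := by
    intro u hu
    obtain ⟨hi, hv⟩ := integral_mul_exp_neg_mul_Ioi hu
    rw [← ofReal_integral_eq_lintegral_ofReal (hi.mul_const _), integral_mul_const, hv]
    · congr 1
      field_simp
    · filter_upwards [ae_restrict_mem measurableSet_Ioi] with y hy
      exact mul_nonneg (mul_nonneg (le_of_lt hy) (Real.exp_pos _).le)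
        (sub_nonneg.2 (Real.cos_le_one u))
  have h2 : ∀ y ∈ Ioi (0 : ℝ), ∫⁻ u in Ioi (0 : ℝ),
      ENNReal.ofReal (y * Real.exp (-(u * y)) * (1 - Real.cos u))
      = ENNReal.ofReal (1 + y ^ 2)⁻¹ := by
    intro y hy
    obtain ⟨hi, hv⟩ := integral_exp_neg_mul_one_sub_cos_Ioi hy
    rw [← ofReal_integral_eq_lintegral_ofReal hi, hv]
    exact Eventually.of_forall fun u => mul_nonneg
      (mul_nonneg (le_of_lt hy) (Real.exp_pos _).le) (sub_nonneg.2 (Real.cos_le_one u))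
  rw [setLIntegral_congr_fun measurableSet_Ioi h1, lintegral_lintegral_swap,
    setLIntegral_congr_fun measurableSet_Ioi h2, ← ofReal_integral_eq_lintegral_ofReal]
  · simp
  · exact integrable_inv_one_add_sq.integrableOn
  · exact Eventually.of_forall fun y => by positivity
  · exact Measurable.aemeasurable (by fun_prop)

lemma integrableOn_one_sub_cos_div_sq :
    IntegrableOn (fun u : ℝ => (1 - Real.cos u) / u ^ 2) (Ioi 0) := by
  refine ⟨Measurable.aestronglyMeasurable (by fun_prop), ?_⟩
  rw [hasFiniteIntegral_iff_ofReal, lintegral_one_sub_cos_div_sq]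
  · exact ENNReal.ofReal_lt_top
  · exact Eventually.of_forall fun u =>
      div_nonneg (sub_nonneg.2 (Real.cos_le_one u)) (sq_nonneg u)

lemma integral_one_sub_cos_div_sq :
    ∫ u in Ioi (0 : ℝ), (1 - Real.cos u) / u ^ 2 = Real.pi / 2 := by
  rw [integral_eq_lintegral_of_nonneg_ae, lintegral_one_sub_cos_div_sq,
    ENNReal.toReal_ofReal (by positivity)]
  · exact Eventually.of_forall fun u =>
      div_nonneg (sub_nonneg.2 (Real.cos_le_one u)) (sq_nonneg u)
  · exact Measurable.aestronglyMeasurable (by fun_prop)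

lemma one_sub_cos_mul_div_sq (β u : ℝ) :
    (1 - Real.cos (β * u)) / u ^ 2
      = β ^ 2 * ((1 - Real.cos (|β| * u)) / (|β| * u) ^ 2) := by
  rcases eq_or_ne β 0 with rfl | hβ
  · simp
  · have hc : Real.cos (|β| * u) = Real.cos (β * u) := by
      rcases abs_choice β with h | h <;> simp [h]
    rw [hc, mul_pow, sq_abs]
    field_simp

lemma integrableOn_one_sub_cos_mul_div_sq (β : ℝ) :
    IntegrableOn (fun u : ℝ => (1 - Real.cos (β * u)) / u ^ 2) (Ioi 0) := by
  simp_rw [one_sub_cos_mul_div_sq β]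
  rcases eq_or_ne β 0 with rfl | hβ
  · simp
  · refine Integrable.const_mul ?_ _
    refine (integrableOn_Ioi_comp_mul_left_iff (fun u : ℝ => (1 - Real.cos u) / u ^ 2) 0
      (abs_pos.2 hβ)).2 ?_
    simpa using integrableOn_one_sub_cos_div_sq

lemma integral_one_sub_cos_mul_div_sq (β : ℝ) :
    ∫ u in Ioi (0 : ℝ), (1 - Real.cos (β * u)) / u ^ 2 = Real.pi / 2 * |β| := by
  simp_rw [one_sub_cos_mul_div_sq β]
  rcases eq_or_ne β 0 with rfl | hβ
  · simp
  · rw [integral_const_mul, integral_comp_mul_left_Ioi (fun u : ℝ => (1 - Real.cos u) / u ^ 2) 0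
      (abs_pos.2 hβ), mul_zero, integral_one_sub_cos_div_sq, smul_eq_mul, ← sq_abs]
    have : |β| ≠ 0 := abs_ne_zero.2 hβ
    field_simp

lemma setIntegral_lt_abs {Q : ℝ → ℂ} {ε : ℝ} (hε : 0 < ε)
    (hQ : IntegrableOn Q {u | ε < |u|}) :
    ∫ u in {u | ε < |u|}, Q u = ∫ u in Ioi ε, (Q u + Q (-u)) := by
  have hset : {u : ℝ | ε < |u|} = Ioi ε ∪ Iio (-ε) := by
    ext u
    simp only [mem_ofPred_eq, lt_abs, mem_union, mem_Ioi, mem_Iio]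
    constructor <;> rintro (h | h) <;> first | (left; linarith) | (right; linarith)
  rw [hset] at hQ ⊢
  have h1 := hQ.mono_set subset_union_left
  have h2 := hQ.mono_set subset_union_right
  have h3 : IntegrableOn (fun u => Q (-u)) (Ioi ε) :=
    h2.comp_neg_Ioi
  rw [setIntegral_union _ measurableSet_Iio h1 h2, integral_add h1 h3, integral_comp_neg_Ioi,
    integral_Iic_eq_integral_Iio]
  refine Set.disjoint_left.2 fun u hu hu' => ?_
  simp only [mem_Ioi, mem_Iio] at hu hu'
  linarith

lemma eq_integral_fourier {P : ℝ → ℂ} (hP : Continuous P) (hi : Integrable P)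
    (hF : Integrable (𝓕 P)) (x : ℝ) :
    P x = ∫ b : ℝ, Complex.exp (((2 * Real.pi * x * b : ℝ) : ℂ) * Complex.I) * 𝓕 P b := by
  conv_lhs => rw [← hP.fourierInv_fourier_eq hi hF, Real.fourierInv_eq']
  congr 1 with b
  simp [mul_assoc]

lemma integrable_exp_mul_fourier {P : ℝ → ℂ} (hF : Integrable (𝓕 P)) (x : ℝ) :
    Integrable fun b : ℝ =>
      Complex.exp (((2 * Real.pi * x * b : ℝ) : ℂ) * Complex.I) * 𝓕 P b :=
  hF.bdd_mul (c := 1) (Continuous.aestronglyMeasurable (by fun_prop))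
    (Eventually.of_forall fun b => by rw [Complex.norm_exp_ofReal_mul_I])

lemma second_difference_eq_integral {P : ℝ → ℂ} (hP : Continuous P) (hi : Integrable P)
    (hF : Integrable (𝓕 P)) (c u : ℝ) :
    P (c + u) + P (c - u) - 2 * P c
      = ∫ b : ℝ, Complex.exp (((2 * Real.pi * c * b : ℝ) : ℂ) * Complex.I) * 𝓕 P b
          * ((-(2 * (1 - Real.cos (2 * Real.pi * b * u))) : ℝ) : ℂ) := by
  rw [eq_integral_fourier hP hi hF (c + u), eq_integral_fourier hP hi hF (c - u),
    eq_integral_fourier hP hi hF c, ← integral_add (integrable_exp_mul_fourier hF _)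
      (integrable_exp_mul_fourier hF _), ← integral_const_mul]
  refine (integral_sub
      ((integrable_exp_mul_fourier hF _).add (integrable_exp_mul_fourier hF _))
      ((integrable_exp_mul_fourier hF _).const_mul 2)).symm.trans ?_
  congr 1 with b
  rw [Pi.add_apply]
  have h1 : (((2 * Real.pi * (c + u) * b : ℝ) : ℂ) * Complex.I)
      = (((2 * Real.pi * c * b : ℝ) : ℂ) * Complex.I)
        + ((2 * Real.pi * b * u : ℝ) : ℂ) * Complex.I := by
    push_cast; ring
  have h2 : (((2 * Real.pi * (c - u) * b : ℝ) : ℂ) * Complex.I)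
      = (((2 * Real.pi * c * b : ℝ) : ℂ) * Complex.I)
        + -((2 * Real.pi * b * u : ℝ) : ℂ) * Complex.I := by
    push_cast; ring
  have h3 := Complex.two_cos ((2 * Real.pi * b * u : ℝ) : ℂ)
  rw [h1, h2, Complex.exp_add, Complex.exp_add]
  have h4 : ((-(2 * (1 - Real.cos (2 * Real.pi * b * u))) : ℝ) : ℂ)
      = 2 * Complex.cos ((2 * Real.pi * b * u : ℝ) : ℂ) - 2 := by
    rw [← Complex.ofReal_cos]
    push_cast
    ring
  rw [h4, h3]
  ring

/-- A symmetric second difference multiplies the Fourier transform by `-2(1 - cos(2πbu))`, and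
integration against `du/u²` turns this into `-2π²|b|`. Integrability of `|b| 𝓕 P` is what Fubini
requires. -/
lemma integrableOn_integral_second_difference {P : ℝ → ℂ} (hP : Continuous P) (hi : Integrable P)
    (hF : Integrable (𝓕 P)) (hF' : Integrable fun b : ℝ => ((|b| : ℝ) : ℂ) * 𝓕 P b) (c : ℝ) :
    IntegrableOn (fun u : ℝ => (P (c + u) + P (c - u) - 2 * P c) / ((u ^ 2 : ℝ) : ℂ)) (Ioi 0) ∧
    ∫ u in Ioi (0 : ℝ), (P (c + u) + P (c - u) - 2 * P c) / ((u ^ 2 : ℝ) : ℂ)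
      = -(2 * Real.pi ^ 2) * ∫ b : ℝ, ((|b| : ℝ) : ℂ) *
          (Complex.exp (((2 * Real.pi * c * b : ℝ) : ℂ) * Complex.I) * 𝓕 P b) := by
  set Φ : ℝ → ℂ := fun b => Complex.exp (((2 * Real.pi * c * b : ℝ) : ℂ) * Complex.I) * 𝓕 P b
    with hΦ
  have hΦi : Integrable Φ := integrable_exp_mul_fourier hF c
  have hΦn : ∀ b, ‖Φ b‖ = ‖𝓕 P b‖ := fun b => by
    rw [hΦ, norm_mul, Complex.norm_exp_ofReal_mul_I, one_mul]
  set k : ℝ → ℝ → ℝ := fun b u => (1 - Real.cos ((2 * Real.pi * b) * u)) / u ^ 2 with hk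
  have hk0 : ∀ b u, 0 ≤ k b u := fun b u =>
    div_nonneg (sub_nonneg.2 (Real.cos_le_one _)) (sq_nonneg u)
  have hkint : ∀ b, ∫ u in Ioi (0 : ℝ), k b u = Real.pi ^ 2 * |b| := fun b => by
    rw [hk, integral_one_sub_cos_mul_div_sq, abs_mul, abs_of_pos (by positivity)]
    ring
  have hint : Integrable (fun z : ℝ × ℝ => Φ z.1 * ((-(2 * k z.1 z.2) : ℝ) : ℂ))
      (volume.prod (volume.restrict (Ioi 0))) := by
    have hmeas : AEStronglyMeasurable (fun z : ℝ × ℝ => Φ z.1 * ((-(2 * k z.1 z.2) : ℝ) : ℂ))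
        (volume.prod (volume.restrict (Ioi 0))) := by
      refine hΦi.aestronglyMeasurable.comp_fst.mul (Measurable.aestronglyMeasurable ?_)
      rw [hk]
      fun_prop
    rw [integrable_prod_iff hmeas]
    constructor
    · exact Eventually.of_forall fun b => Integrable.const_mul
        (Integrable.ofReal (f := fun u => -(2 * k b u))
          ((integrableOn_one_sub_cos_mul_div_sq (2 * Real.pi * b)).const_mul 2).neg) (Φ b)
    · have h1 : Integrable fun b : ℝ => 2 * Real.pi ^ 2 * ‖((|b| : ℝ) : ℂ) * 𝓕 P b‖ :=
        hF'.norm.const_mul _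
      refine h1.congr (Eventually.of_forall fun b => ?_)
      simp only [norm_mul, hΦn, Complex.norm_real, norm_neg, Real.norm_eq_abs, abs_abs, abs_two,
        abs_of_nonneg (hk0 _ _)]
      rw [integral_const_mul, integral_const_mul, hkint]
      ring
  have heq : ∀ u, (P (c + u) + P (c - u) - 2 * P c) / ((u ^ 2 : ℝ) : ℂ)
      = ∫ b, Φ b * ((-(2 * k b u) : ℝ) : ℂ) := fun u => by
    rw [second_difference_eq_integral hP hi hF, div_eq_mul_inv, ← integral_mul_const]
    congr 1 with b
    simp only [hk, hΦ]
    push_cast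
    ring
  simp_rw [heq]
  refine ⟨hint.integral_prod_right, ?_⟩
  rw [← integral_integral_swap hint, ← integral_const_mul]
  congr 1 with b
  rw [integral_const_mul, integral_complex_ofReal, integral_neg, integral_const_mul, hkint]
  simp only [hΦ]
  push_cast
  ring

/-- The Hadamard finite part of `∫ P(s) / (c - s)² ds` in terms of the Fourier transform of `P`. -/
lemma tendsto_finitePart {P : ℝ → ℂ} (hP : Continuous P) (hi : Integrable P)
    (hF : Integrable (𝓕 P)) (hF' : Integrable fun b : ℝ => ((|b| : ℝ) : ℂ) * 𝓕 P b) (c : ℝ) :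
    Tendsto (fun ε : ℝ => (∫ s in {s : ℝ | ε < |c - s|}, P s / (((c - s) ^ 2 : ℝ) : ℂ))
        - 2 * P c / (ε : ℂ)) (𝓝[>] 0)
      (𝓝 (-(2 * Real.pi ^ 2) * ∫ b : ℝ, ((|b| : ℝ) : ℂ) *
          (Complex.exp (((2 * Real.pi * c * b : ℝ) : ℂ) * Complex.I) * 𝓕 P b))) := by
  obtain ⟨h1, h2⟩ := integrableOn_integral_second_difference hP hi hF hF' c
  have hcov := (aecover_Ioi_of_Ioi (μ := volume) (A := (0 : ℝ)) (a := id) (l := 𝓝[>] (0 : ℝ))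
    (tendsto_id.mono_left nhdsWithin_le_nhds)).integral_tendsto_of_countably_generated h1
  rw [← h2]
  refine hcov.congr' ?_
  filter_upwards [self_mem_nhdsWithin] with ε hε
  have hε : 0 < ε := hε
  simp only [id]
  rw [Measure.restrict_restrict measurableSet_Ioi,
    inter_eq_left.2 (Ioi_subset_Ioi hε.le)]
  have hmeas : MeasurableSet {u : ℝ | ε < |u|} := measurableSet_lt measurable_const (by fun_prop)
  -- Away from the singularity the kernel is at most `ε⁻²`, so integrability of `P` suffices.
  have hQ : IntegrableOn (fun u : ℝ => P (c + u) / ((u ^ 2 : ℝ) : ℂ)) {u : ℝ | ε < |u|} := by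
    have h3 : Integrable (fun u : ℝ => ‖P (c + u)‖ * (ε ^ 2)⁻¹) :=
      (hi.comp_add_left c).norm.mul_const _
    refine (h3.integrableOn (s := {u : ℝ | ε < |u|})).mono' ?_ ?_
    · exact Measurable.aestronglyMeasurable (by fun_prop)
    · filter_upwards [ae_restrict_mem hmeas] with u hu
      rw [norm_div, Complex.norm_real, norm_pow, Real.norm_eq_abs, div_eq_mul_inv]
      have : ε < |u| := hu
      gcongr
  have htr : ∫ s in {s : ℝ | ε < |c - s|}, P s / (((c - s) ^ 2 : ℝ) : ℂ)
      = ∫ u in {u : ℝ | ε < |u|}, P (c + u) / ((u ^ 2 : ℝ) : ℂ) := by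
    have hm' : MeasurableSet {s : ℝ | ε < |c - s|} := measurableSet_lt measurable_const (by fun_prop)
    rw [← integral_indicator hm', ← integral_indicator hmeas, ← integral_add_left_eq_self _ c]
    congr 1 with u
    simp [indicator]
  -- The divergent term is `2P(c)/ε = ∫_ε^∞ 2P(c) u⁻² du`; subtracting it from the folded truncated
  -- integral leaves exactly the second difference on `(ε, ∞)`.
  have hsq : IntegrableOn (fun u : ℝ => 2 * P c * ((u ^ (-2 : ℝ) : ℝ) : ℂ)) (Ioi ε) :=
    ((integrableOn_Ioi_rpow_of_lt (by norm_num) hε).ofReal).const_mul _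
  have hval : ∫ u in Ioi ε, 2 * P c * ((u ^ (-2 : ℝ) : ℝ) : ℂ) = 2 * P c / (ε : ℂ) := by
    rw [integral_const_mul, integral_complex_ofReal, integral_Ioi_rpow_of_lt (by norm_num) hε,
      show (-2 : ℝ) + 1 = -1 by norm_num, Real.rpow_neg_one]
    simp [div_eq_mul_inv]
  rw [htr, setIntegral_lt_abs hε hQ, ← hval, eq_sub_iff_add_eq,
    ← integral_add (h1.mono_set (Ioi_subset_Ioi hε.le)) hsq]
  refine setIntegral_congr_fun measurableSet_Ioi fun u hu => ?_
  have hu0 : 0 < u := hε.trans hu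
  rw [Real.rpow_neg hu0.le, Real.rpow_two, neg_sq, ← sub_eq_add_neg c u]
  push_cast
  ring

end FinitePart

/-! ### Diagonal scalings, the splitting of the last coordinate, and the profile in its square. -/

section Geometry

variable {d : ℕ}

@[simp]
lemma point_castSucc (y : EuclideanSpace ℝ (Fin d)) (s : ℝ) (i : Fin d) :
    point y s i.castSucc = y i := by
  simp [point]

@[simp]
lemma point_last (y : EuclideanSpace ℝ (Fin d)) (s : ℝ) : point y s (Fin.last d) = s := by
  simp [point]

lemma point_sub_point (y u : EuclideanSpace ℝ (Fin d)) (s t : ℝ) :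
    point y s - point u t = point (y - u) (s - t) := by
  ext i
  refine Fin.lastCases ?_ (fun j => ?_) i <;> simp

lemma norm_point_sq (y : EuclideanSpace ℝ (Fin d)) (s : ℝ) :
    ‖point y s‖ ^ 2 = ‖y‖ ^ 2 + s ^ 2 := by
  simp [EuclideanSpace.norm_sq_eq, Fin.sum_univ_castSucc]

@[simp]
lemma diagInv_apply {m : ℕ} (a : Fin m → ℝ) (x : EuclideanSpace ℝ (Fin m)) (i : Fin m) :
    diagInv a x i = (a i)⁻¹ * x i := rfl

lemma diagInv_sub {m : ℕ} (a : Fin m → ℝ) (x y : EuclideanSpace ℝ (Fin m)) :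
    diagInv a (x - y) = diagInv a x - diagInv a y := by
  ext i
  simp [mul_sub]

lemma diagInv_point (a : Fin (d + 1) → ℝ) (y : EuclideanSpace ℝ (Fin d)) (s : ℝ) :
    diagInv a (point y s)
      = point (diagInv (fun i => a i.castSucc) y) ((a (Fin.last d))⁻¹ * s) := by
  ext i
  refine Fin.lastCases ?_ (fun j => ?_) i <;> simp

lemma diagInv_inv_diagInv {m : ℕ} {a : Fin m → ℝ} (ha : ∀ i, 0 < a i)
    (x : EuclideanSpace ℝ (Fin m)) : diagInv (fun i => (a i)⁻¹) (diagInv a x) = x := by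
  ext i
  have := (ha i).ne'
  simp [this]

lemma diagInv_diagInv_inv {m : ℕ} {a : Fin m → ℝ} (ha : ∀ i, 0 < a i)
    (x : EuclideanSpace ℝ (Fin m)) : diagInv a (diagInv (fun i => (a i)⁻¹) x) = x := by
  ext i
  have := (ha i).ne'
  simp [this]

lemma contDiff_diagInv {m : ℕ} (a : Fin m → ℝ) : ContDiff ℝ ∞ (diagInv a) := by
  rw [contDiff_euclidean]
  intro i
  simp only [diagInv_apply]
  fun_prop

/-- `x ↦ A⁻¹ x` as a homeomorphism. -/
def diagInvHomeomorph {m : ℕ} (a : Fin m → ℝ) (ha : ∀ i, 0 < a i) :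
    EuclideanSpace ℝ (Fin m) ≃ₜ EuclideanSpace ℝ (Fin m) where
  toFun := diagInv a
  invFun := diagInv fun i => (a i)⁻¹
  left_inv := diagInv_inv_diagInv ha
  right_inv := diagInv_diagInv_inv ha
  continuous_toFun := (contDiff_diagInv a).continuous
  continuous_invFun := (contDiff_diagInv _).continuous

lemma map_diagInv_volume {m : ℕ} {a : Fin m → ℝ} (ha : ∀ i, 0 < a i) :
    Measure.map (diagInv a) volume = ENNReal.ofReal (∏ i, a i) • volume := by
  have hpos : 0 < ∏ i, a i := Finset.prod_pos fun i _ => ha i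
  have hdet : (Matrix.diagonal fun i => (a i)⁻¹).det = (∏ i, a i)⁻¹ := by
    rw [Matrix.det_diagonal, Finset.prod_inv_distrib]
  have h := Real.smul_map_diagonal_volume_pi (D := fun i => (a i)⁻¹)
    (by rw [hdet]; exact (inv_pos.2 hpos).ne')
  rw [hdet, abs_of_pos (inv_pos.2 hpos)] at h
  have h' : Measure.map (Matrix.toLin' (Matrix.diagonal fun i => (a i)⁻¹)) volume
      = ENNReal.ofReal (∏ i, a i) • volume := by
    conv_rhs => rw [← h]
    rw [smul_smul, ← ENNReal.ofReal_mul hpos.le, mul_inv_cancel₀ hpos.ne',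
      ENNReal.ofReal_one, one_smul]
  have hcomp : diagInv a = WithLp.toLp 2 ∘ Matrix.toLin' (Matrix.diagonal fun i => (a i)⁻¹)
      ∘ WithLp.ofLp := by
    ext x i
    simp [Matrix.mulVec_diagonal]
  have hm : Measurable (Matrix.toLin' (Matrix.diagonal fun i => (a i)⁻¹)) :=
    (LinearMap.continuous_of_finiteDimensional _).measurable
  rw [hcomp, ← Measure.map_map (WithLp.measurable_toLp 2 _)
    (hm.comp (WithLp.measurable_ofLp 2 _)), ← Measure.map_map hm (WithLp.measurable_ofLp 2 _),
    (PiLp.volume_preserving_ofLp (Fin m)).map_eq, h', Measure.map_smul,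
    (PiLp.volume_preserving_toLp (Fin m)).map_eq]

lemma measurableEmbedding_diagInv {m : ℕ} {a : Fin m → ℝ} (ha : ∀ i, 0 < a i) :
    MeasurableEmbedding (diagInv a) :=
  (diagInvHomeomorph a ha).measurableEmbedding

lemma integral_comp_diagInv {m : ℕ} {a : Fin m → ℝ} (ha : ∀ i, 0 < a i)
    (F : EuclideanSpace ℝ (Fin m) → ℂ) :
    ∫ x, F (diagInv a x) = ((∏ i, a i : ℝ) : ℂ) * ∫ y, F y := by
  rw [← (measurableEmbedding_diagInv ha).integral_map, map_diagInv_volume ha,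
    integral_smul_measure, ENNReal.toReal_ofReal (Finset.prod_pos fun i _ => ha i).le,
    Complex.real_smul]

lemma integrable_comp_diagInv {m : ℕ} {a : Fin m → ℝ} (ha : ∀ i, 0 < a i)
    {F : EuclideanSpace ℝ (Fin m) → ℂ} (hF : Integrable F) :
    Integrable fun x => F (diagInv a x) := by
  refine (measurableEmbedding_diagInv ha).integrable_map_iff.1 ?_
  rw [map_diagInv_volume ha]
  exact hF.smul_measure ENNReal.ofReal_ne_top

/-- `(y, s) ↦ point y s` as an isometry of the Euclidean product. -/
def pointIsometry (d : ℕ) :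
    WithLp 2 (EuclideanSpace ℝ (Fin d) × ℝ) ≃ₗᵢ[ℝ] EuclideanSpace ℝ (Fin (d + 1)) where
  toFun w := point w.fst w.snd
  invFun x := WithLp.toLp 2 (WithLp.toLp 2 fun i => x i.castSucc, x (Fin.last d))
  left_inv w := by
    refine (WithLp.ofLp_injective 2) (Prod.ext ?_ ?_)
    · ext i
      simp
    · simp
  right_inv x := by
    ext i
    refine Fin.lastCases ?_ (fun j => ?_) i <;> simp
  map_add' v w := by
    ext i
    refine Fin.lastCases ?_ (fun j => ?_) i <;> simp
  map_smul' c w := by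
    ext i
    refine Fin.lastCases ?_ (fun j => ?_) i <;> simp
  norm_map' w := by
    rw [← sq_eq_sq₀ (norm_nonneg _) (norm_nonneg _), WithLp.prod_norm_sq_eq_of_L2]
    simp [norm_point_sq]

lemma measurePreserving_point :
    MeasurePreserving (fun z : EuclideanSpace ℝ (Fin d) × ℝ => point z.1 z.2) :=
  (pointIsometry d).measurePreserving.comp (WithLp.volume_preserving_toLp _ ℝ)

lemma measurableEmbedding_point :
    MeasurableEmbedding (fun z : EuclideanSpace ℝ (Fin d) × ℝ => point z.1 z.2) :=
  (pointIsometry d).toHomeomorph.measurableEmbedding.comp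
    (MeasurableEquiv.toLp 2 (EuclideanSpace ℝ (Fin d) × ℝ)).measurableEmbedding

lemma contDiff_point :
    ContDiff ℝ ∞ (fun z : EuclideanSpace ℝ (Fin d) × ℝ => point z.1 z.2) := by
  rw [contDiff_euclidean]
  intro i
  refine Fin.lastCases ?_ (fun j => ?_) i
  · simp only [point_last]
    fun_prop
  · simp only [point_castSucc]
    fun_prop

lemma Admissible.comp_diagInv {f : EuclideanSpace ℝ (Fin (d + 1)) → ℂ} (hf : Admissible f)
    {b : Fin (d + 1) → ℝ} (hb : ∀ i, 0 < b i) : Admissible (fun x => f (diagInv b x)) where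
  smooth := hf.smooth.comp (contDiff_diagInv b)
  compactSupport := hf.compactSupport.comp_homeomorph (diagInvHomeomorph b hb)
  support_subset := fun x hx => by
    have h1 := hf.support_subset
      (tsupport_comp_subset_preimage f (contDiff_diagInv b).continuous hx)
    intro h0
    exact h1 (by simp [h0])
  even y s := by
    rw [diagInv_point, diagInv_point, mul_neg, hf.even]

/-- The last coordinate maps the compact support to a compact set that misses `0`, hence misses a
neighbourhood of `0`. -/
lemma Admissible.exists_eq_zero {g : EuclideanSpace ℝ (Fin (d + 1)) → ℂ} (hg : Admissible g) :
    ∃ δ > 0, ∀ x, |x (Fin.last d)| < δ → g x = 0 := by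
  have hK : IsCompact ((fun x : EuclideanSpace ℝ (Fin (d + 1)) => x (Fin.last d)) '' tsupport g) :=
    hg.compactSupport.isCompact.image (by fun_prop)
  have h0 : (0 : ℝ) ∈ ((fun x : EuclideanSpace ℝ (Fin (d + 1)) => x (Fin.last d)) '' tsupport g)ᶜ := by
    rintro ⟨x, hx, hx0⟩
    exact hg.support_subset hx hx0
  obtain ⟨δ, hδ, hball⟩ := Metric.isOpen_iff.1 hK.isClosed.isOpen_compl 0 h0
  refine ⟨δ, hδ, fun x hx => ?_⟩
  by_contra hne
  exact hball (by simpa using hx) ⟨x, subset_tsupport g hne, rfl⟩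

/-- The density `G (y, v)` of the image of `g (y, s) ds` under `v = s²`, for `g` even in `s`. -/
def squareProfile (g : EuclideanSpace ℝ (Fin (d + 1)) → ℂ) (z : EuclideanSpace ℝ (Fin d) × ℝ) : ℂ :=
  if 0 < z.2 then g (point z.1 √z.2) / ((√z.2 : ℝ) : ℂ) else 0

/-- The square root is smooth for `v > 0`, and the profile vanishes identically for `v < δ²`, so the
singularity at `v = 0` plays no role. -/
lemma Admissible.contDiff_squareProfile {g : EuclideanSpace ℝ (Fin (d + 1)) → ℂ}
    (hg : Admissible g) : ContDiff ℝ ∞ (squareProfile g) := by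
  rw [contDiff_iff_contDiffAt]
  intro z
  rcases lt_or_ge 0 z.2 with hz | hz
  · have hs : ContDiffAt ℝ ∞ (fun z : EuclideanSpace ℝ (Fin d) × ℝ => √z.2) z :=
      contDiffAt_snd.sqrt hz.ne'
    have h1 : ContDiffAt ℝ ∞
        (fun z : EuclideanSpace ℝ (Fin d) × ℝ => g (point z.1 √z.2) / ((√z.2 : ℝ) : ℂ)) z := by
      have h2 : ContDiffAt ℝ ∞
          (fun z : EuclideanSpace ℝ (Fin d) × ℝ => g (point z.1 √z.2)) z :=
        (hg.smooth.comp contDiff_point).contDiffAt.comp z (contDiffAt_fst.prodMk hs)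
      have h3 : ContDiffAt ℝ ∞ (fun z : EuclideanSpace ℝ (Fin d) × ℝ => ((√z.2 : ℝ) : ℂ)) z :=
        Complex.ofRealCLM.contDiff.contDiffAt.comp z hs
      simp_rw [div_eq_mul_inv]
      exact h2.mul (h3.inv (by exact_mod_cast (Real.sqrt_pos.2 hz).ne'))
    refine h1.congr_of_eventuallyEq ?_
    filter_upwards [continuous_snd.continuousAt.eventually (lt_mem_nhds hz)] with w hw
    simp [squareProfile, hw]
  · obtain ⟨δ, hδ, h0⟩ := hg.exists_eq_zero
    refine (contDiffAt_const (c := (0 : ℂ))).congr_of_eventuallyEq ?_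
    filter_upwards [continuous_snd.continuousAt.eventually
      (gt_mem_nhds (lt_of_le_of_lt hz (sq_pos_of_pos hδ)))] with w hw
    simp only [squareProfile]
    split_ifs with hw0
    · rw [h0, zero_div]
      rw [point_last, abs_of_nonneg (Real.sqrt_nonneg _)]
      exact (Real.sqrt_lt' hδ).2 hw
    · rfl

lemma Admissible.hasCompactSupport_squareProfile {g : EuclideanSpace ℝ (Fin (d + 1)) → ℂ}
    (hg : Admissible g) : HasCompactSupport (squareProfile g) := by
  have hcont : Continuous fun x : EuclideanSpace ℝ (Fin (d + 1)) =>
      (((pointIsometry d).symm x).fst, ((pointIsometry d).symm x).snd ^ 2) := by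
    fun_prop
  refine HasCompactSupport.intro (hg.compactSupport.isCompact.image hcont) fun z hz => ?_
  by_contra hne
  simp only [squareProfile] at hne
  split_ifs at hne with hz0
  · refine hz ⟨point z.1 √z.2, subset_tsupport g fun h => hne (by rw [h, zero_div]), ?_⟩
    have : (pointIsometry d).symm (point z.1 √z.2) = WithLp.toLp 2 (z.1, √z.2) := by
      rw [LinearIsometryEquiv.symm_apply_eq]
      rfl
    simp only [this]
    simp [Real.sq_sqrt hz0.le]
  · exact hne rfl

lemma squareProfile_of_nonpos (g : EuclideanSpace ℝ (Fin (d + 1)) → ℂ)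
    (y : EuclideanSpace ℝ (Fin d)) {v : ℝ} (hv : v ≤ 0) : squareProfile g (y, v) = 0 := by
  simp [squareProfile, not_lt.2 hv]

end Geometry

/-! ### The substitution `s = τ²` on the half-line. -/

section Substitution

open Set

lemma integral_Ioi_eq_integral_comp_sq (m : ℝ → ℂ) :
    ∫ s in Ioi (0 : ℝ), m s = ∫ τ in Ioi (0 : ℝ), ((2 * τ : ℝ) : ℂ) * m (τ ^ 2) := by
  rw [← integral_comp_rpow_Ioi_of_pos (g := m) (p := 2) two_pos]
  refine setIntegral_congr_fun measurableSet_Ioi fun τ _ => ?_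
  norm_num

lemma integrableOn_Ioi_comp_sq {m : ℝ → ℂ} (hm : IntegrableOn m (Ioi 0)) :
    IntegrableOn (fun τ : ℝ => ((2 * τ : ℝ) : ℂ) * m (τ ^ 2)) (Ioi 0) := by
  refine ((integrableOn_Ioi_comp_rpow_iff m (p := 2) two_ne_zero).2 hm).congr_fun (fun τ _ => ?_)
    measurableSet_Ioi
  norm_num

/-- The two half-lines contribute equally, and this factor `2` cancels the one in `ds = dv/(2√v)`.
-/
lemma integral_even_eq_integral_sqrt {F : ℝ → ℂ} (hF : Integrable F) (he : ∀ s, F (-s) = F s) :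
    ∫ s, F s = ∫ v in Ioi (0 : ℝ), F √v / ((√v : ℝ) : ℂ) := by
  rw [← intervalIntegral.integral_Iic_add_Ioi (b := 0) hF.integrableOn hF.integrableOn,
    integral_Ioi_eq_integral_comp_sq (fun v => F √v / ((√v : ℝ) : ℂ))]
  have h1 : ∫ s in Iic (0 : ℝ), F s = ∫ s in Ioi (0 : ℝ), F s := by
    have := integral_comp_neg_Iic (0 : ℝ) F
    simp only [he, neg_zero] at this
    exact this
  rw [h1, ← two_mul, ← integral_const_mul]
  refine setIntegral_congr_fun measurableSet_Ioi fun τ hτ => ?_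
  have hτ : 0 < τ := hτ
  have : (τ : ℂ) ≠ 0 := by exact_mod_cast hτ.ne'
  rw [Real.sqrt_sq hτ.le]
  push_cast
  field_simp

end Substitution

/-! ### The elliptical Radon transform through paraboloid integrals, and its inversion. -/

section Radon

open Set
open scoped FourierTransform

variable {d : ℕ} {a : Fin (d + 1) → ℝ} {f : EuclideanSpace ℝ (Fin (d + 1)) → ℂ}

/-- The profile of `f ∘ A` in the squared last variable. -/
def scaledProfile (a : Fin (d + 1) → ℝ) (f : EuclideanSpace ℝ (Fin (d + 1)) → ℂ) :
    EuclideanSpace ℝ (Fin d) × ℝ → ℂ :=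
  squareProfile fun y => f (diagInv (fun i => (a i)⁻¹) y)

/-- The density of the image of `f(x) dx` under `s = |A⁻¹ (x - (u, 0))|²`, up to the factor
`a_1 ⋯ a_n`. -/
def radiusSqDensity (a : Fin (d + 1) → ℝ) (f : EuclideanSpace ℝ (Fin (d + 1)) → ℂ)
    (u : EuclideanSpace ℝ (Fin d)) : ℝ → ℂ :=
  paraboloidIntegral (scaledProfile a f) (diagInv (fun i => a i.castSucc) u)

lemma contDiff_scaledProfile (ha : ∀ i, 0 < a i) (hf : Admissible f) :
    ContDiff ℝ ∞ (scaledProfile a f) :=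
  (hf.comp_diagInv fun i => inv_pos.2 (ha i)).contDiff_squareProfile

lemma hasCompactSupport_scaledProfile (ha : ∀ i, 0 < a i) (hf : Admissible f) :
    HasCompactSupport (scaledProfile a f) :=
  (hf.comp_diagInv fun i => inv_pos.2 (ha i)).hasCompactSupport_squareProfile

lemma continuous_radiusSqDensity (ha : ∀ i, 0 < a i) (hf : Admissible f)
    (u : EuclideanSpace ℝ (Fin d)) : Continuous (radiusSqDensity a f u) :=
  continuous_paraboloidIntegral (contDiff_scaledProfile ha hf).continuous
    (hasCompactSupport_scaledProfile ha hf) _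

lemma integrable_radiusSqDensity (ha : ∀ i, 0 < a i) (hf : Admissible f)
    (u : EuclideanSpace ℝ (Fin d)) : Integrable (radiusSqDensity a f u) :=
  integrable_paraboloidIntegral (contDiff_scaledProfile ha hf).continuous
    (hasCompactSupport_scaledProfile ha hf) _

lemma radiusSqDensity_of_nonpos (a : Fin (d + 1) → ℝ) (f : EuclideanSpace ℝ (Fin (d + 1)) → ℂ)
    (u : EuclideanSpace ℝ (Fin d)) {s : ℝ} (hs : s ≤ 0) : radiusSqDensity a f u s = 0 := by
  rw [radiusSqDensity, paraboloidIntegral, ← integral_zero (EuclideanSpace ℝ (Fin d)) ℂ]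
  congr 1 with y
  exact squareProfile_of_nonpos _ _ (sub_nonpos.2 (hs.trans (sq_nonneg _)))

lemma setIntegral_Ioi_mul_radiusSqDensity (u : EuclideanSpace ℝ (Fin d)) (k : ℝ → ℂ) :
    ∫ s in Ioi (0 : ℝ), k s * radiusSqDensity a f u s = ∫ s, k s * radiusSqDensity a f u s := by
  refine setIntegral_eq_integral_of_forall_compl_eq_zero fun s hs => ?_
  rw [radiusSqDensity_of_nonpos a f u (not_lt.1 hs), mul_zero]

/-- In the coordinates `A⁻¹x = (y, s)` with `v = s²`, the squared radius is `v + |y - α|²`, so the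
level sets are the translated paraboloids; `∏ a i` is the Jacobian of the scaling. -/
lemma integral_comp_ellipsoidalRadius_sq (ha : ∀ i, 0 < a i) (hf : Admissible f)
    (u : EuclideanSpace ℝ (Fin d)) {k : ℝ → ℂ} (hk : Measurable k) {M : ℝ}
    (hM : ∀ s, ‖k s‖ ≤ M) :
    ∫ x, k (ellipsoidalRadius a u x ^ 2) * f x
      = ((∏ i, a i : ℝ) : ℂ) * ∫ s, k s * radiusSqDensity a f u s := by
  set g : EuclideanSpace ℝ (Fin (d + 1)) → ℂ := fun y => f (diagInv (fun i => (a i)⁻¹) y) with hg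
  have hgA : Admissible g := hf.comp_diagInv fun i => inv_pos.2 (ha i)
  set α := diagInv (fun i => a i.castSucc) u with hα
  have h1 : ∀ x, k (ellipsoidalRadius a u x ^ 2) * f x
      = (fun y => k (‖y - point α 0‖ ^ 2) * g y) (diagInv a x) := by
    intro x
    simp only [hg, ellipsoidalRadius, diagInv_inv_diagInv ha, diagInv_sub, diagInv_point, mul_zero,
      hα]
  simp_rw [h1]
  rw [integral_comp_diagInv ha (fun y => k (‖y - point α 0‖ ^ 2) * g y),
    ← measurePreserving_point.integral_comp measurableEmbedding_point]
  congr 1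
  have hint : Integrable (fun z : EuclideanSpace ℝ (Fin d) × ℝ =>
      k (‖z.1 - α‖ ^ 2 + z.2 ^ 2) * g (point z.1 z.2)) (volume.prod volume) := by
    have h2 : Integrable g :=
      hgA.smooth.continuous.integrable_of_hasCompactSupport hgA.compactSupport
    exact ((measurePreserving_point.integrable_comp_emb measurableEmbedding_point).2 h2).bdd_mul
      (hk.comp (by fun_prop)).aestronglyMeasurable (Eventually.of_forall fun z => hM _)
  have h3 : ∀ z : EuclideanSpace ℝ (Fin d) × ℝ,
      k (‖point z.1 z.2 - point α 0‖ ^ 2) * g (point z.1 z.2)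
        = k (‖z.1 - α‖ ^ 2 + z.2 ^ 2) * g (point z.1 z.2) := fun z => by
    rw [point_sub_point, norm_point_sq, sub_zero]
  simp_rw [h3]
  rw [radiusSqDensity, integral_mul_paraboloidIntegral (contDiff_scaledProfile ha hf).continuous
    (hasCompactSupport_scaledProfile ha hf) _ hk hM, Measure.volume_eq_prod, integral_prod _ hint]
  refine integral_congr_ae ?_
  filter_upwards [hint.prod_right_ae] with y hy
  rw [integral_even_eq_integral_sqrt hy fun s => by simp only [neg_sq, hgA.even],
    ← integral_indicator measurableSet_Ioi]
  congr 1 with v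
  by_cases hv : 0 < v
  · rw [indicator_of_mem (mem_Ioi.2 hv), Real.sq_sqrt hv.le, add_comm v]
    simp only [scaledProfile, squareProfile, hv, if_true, hg, mul_div_assoc, hα]
  · rw [indicator_of_notMem (by simpa using hv)]
    simp [scaledProfile, squareProfile, hv]

/-- Symmetric means of a continuous function converge to its values. -/
lemma tendsto_symmetric_mean {r : ℝ → ℂ} (hr : Continuous r) (t : ℝ) :
    Tendsto (fun ε : ℝ => (2 * ε)⁻¹ • ∫ τ in (t - ε)..(t + ε), r τ) (𝓝[>] 0) (𝓝 (r t)) := by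
  have hF : ∀ x, HasDerivAt (fun x => ∫ τ in (0 : ℝ)..x, r τ) (r x) x := fun x =>
    intervalIntegral.integral_hasDerivAt_right (hr.intervalIntegrable _ _)
      (hr.stronglyMeasurableAtFilter _ _) hr.continuousAt
  have h1 : HasDerivAt (fun ε : ℝ => t + ε) 1 0 := (hasDerivAt_id (0 : ℝ)).const_add t
  have h2 : HasDerivAt (fun ε : ℝ => t - ε) (-1) 0 := (hasDerivAt_id (0 : ℝ)).const_sub t
  -- The integral over `(t - ε, t + ε)` vanishes at `ε = 0` and has derivative `2 r t` there.
  have h3 := ((hF (t + 0)).scomp (0 : ℝ) h1).sub ((hF (t - 0)).scomp (0 : ℝ) h2)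
  have h4 := (h3.tendsto_slope_zero_right).const_smul (2⁻¹ : ℝ)
  convert h4 using 2 with ε
  · rw [smul_smul, ← mul_inv]
    congr 1
    simp only [Pi.sub_apply, Function.comp_apply, zero_add, add_zero, sub_zero, sub_self]
    rw [intervalIntegral.integral_interval_sub_left (hr.intervalIntegrable _ _)
      (hr.intervalIntegrable _ _)]
  · simp only [add_zero, sub_zero]
    module

/-- The explicit form of the elliptical Radon transform. -/
def radonProfile (a : Fin (d + 1) → ℝ) (f : EuclideanSpace ℝ (Fin (d + 1)) → ℂ)
    (u : EuclideanSpace ℝ (Fin d)) (t : ℝ) : ℂ :=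
  ((∏ i, a i : ℝ) : ℂ) * (((2 * max t 0 : ℝ) : ℂ) * radiusSqDensity a f u (t ^ 2))

lemma hasDeltaIntegral_ellipsoidalRadius (ha : ∀ i, 0 < a i) (hf : Admissible f)
    (u : EuclideanSpace ℝ (Fin d)) (t : ℝ) :
    HasDeltaIntegral (ellipsoidalRadius a u) t f (radonProfile a f u t) := by
  -- With `max t 0` the profile extends continuously by zero to `t < 0`, where no radii lie; hence
  -- the means converge at `t = 0` too.
  have hcont : Continuous (radonProfile a f u) := by
    have := continuous_radiusSqDensity ha hf u
    unfold radonProfile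
    fun_prop
  refine (tendsto_symmetric_mean hcont t).congr' ?_
  filter_upwards [self_mem_nhdsWithin] with ε hε
  have hε : 0 < ε := hε
  congr 1
  -- The window around `t`, written as a function of the squared radius.
  set k : ℝ → ℂ := indicator {s | |√s - t| < ε} 1 with hk
  have hkset : MeasurableSet {s : ℝ | |√s - t| < ε} :=
    measurableSet_lt (by fun_prop) measurable_const
  have hkm : Measurable k := measurable_one.indicator hkset
  have hk1 : ∀ s, ‖k s‖ ≤ 1 := fun s => by
    rw [hk]
    refine (norm_indicator_le_norm_self _ _).trans ?_
    simp
  have hcontr : Continuous (ellipsoidalRadius a u) := by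
    have := (contDiff_diagInv a).continuous
    unfold ellipsoidalRadius
    fun_prop
  have hset : MeasurableSet {x | |ellipsoidalRadius a u x - t| < ε} :=
    measurableSet_lt (by fun_prop) measurable_const
  have h1 : ∫ x in {x | |ellipsoidalRadius a u x - t| < ε}, f x
      = ∫ x, k (ellipsoidalRadius a u x ^ 2) * f x := by
    rw [← integral_indicator hset]
    congr 1 with x
    have : √(ellipsoidalRadius a u x ^ 2) = ellipsoidalRadius a u x :=
      Real.sqrt_sq (norm_nonneg _)
    simp [hk, indicator, this]
  rw [h1, integral_comp_ellipsoidalRadius_sq ha hf u hkm hk1,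
    ← setIntegral_Ioi_mul_radiusSqDensity, integral_Ioi_eq_integral_comp_sq,
    intervalIntegral.integral_of_le (by linarith), integral_Ioc_eq_integral_Ioo,
    ← integral_const_mul, ← integral_indicator measurableSet_Ioi,
    ← integral_indicator measurableSet_Ioo]
  congr 1 with τ
  by_cases hτ : 0 < τ
  · have hiff : τ ∈ Ioo (t - ε) (t + ε) ↔ |τ - t| < ε := by
      rw [mem_Ioo, abs_lt]
      constructor <;> rintro ⟨h, h'⟩ <;> constructor <;> linarith
    rw [indicator_of_mem (mem_Ioi.2 hτ)]
    by_cases h : |τ - t| < ε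
    · rw [indicator_of_mem (hiff.2 h)]
      simp [hk, Real.sqrt_sq hτ.le, h, radonProfile, max_eq_left hτ.le]
    · rw [indicator_of_notMem (hiff.not.2 h)]
      simp [hk, Real.sqrt_sq hτ.le, h]
  · rw [indicator_of_notMem (s := Ioi 0) (by simpa using hτ)]
    simp [indicator, radonProfile, max_eq_right (not_lt.1 hτ)]

lemma ellipticalRadon_eq (ha : ∀ i, 0 < a i) (hf : Admissible f)
    (u : EuclideanSpace ℝ (Fin d)) (t : ℝ) : ellipticalRadon a f u t = radonProfile a f u t :=
  (hasDeltaIntegral_ellipsoidalRadius ha hf u t).limUnder_eq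

lemma ellipticalRadon_of_pos (ha : ∀ i, 0 < a i) (hf : Admissible f)
    (u : EuclideanSpace ℝ (Fin d)) {t : ℝ} (ht : 0 < t) :
    ellipticalRadon a f u t
      = ((∏ i, a i : ℝ) : ℂ) * (((2 * t : ℝ) : ℂ) * radiusSqDensity a f u (t ^ 2)) := by
  rw [ellipticalRadon_eq ha hf, radonProfile, max_eq_left ht.le]

lemma integrableOn_ellipticalRadon (ha : ∀ i, 0 < a i) (hf : Admissible f)
    (u : EuclideanSpace ℝ (Fin d)) : IntegrableOn (ellipticalRadon a f u) (Ioi 0) :=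
  IntegrableOn.congr_fun
    ((integrableOn_Ioi_comp_sq (integrable_radiusSqDensity ha hf u).integrableOn).const_mul _)
    (fun _ ht => (ellipticalRadon_of_pos ha hf u ht).symm) measurableSet_Ioi

/-- The factor `2τ` in the transform is the Jacobian of `s = τ²`. -/
lemma setIntegral_mul_ellipticalRadon (ha : ∀ i, 0 < a i) (hf : Admissible f)
    (u : EuclideanSpace ℝ (Fin d)) (k : ℝ → ℂ) :
    ∫ τ in Ioi (0 : ℝ), k (τ ^ 2) * ellipticalRadon a f u τ
      = ((∏ i, a i : ℝ) : ℂ) * ∫ s, k s * radiusSqDensity a f u s := by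
  rw [← setIntegral_Ioi_mul_radiusSqDensity,
    integral_Ioi_eq_integral_comp_sq (fun s => k s * radiusSqDensity a f u s),
    ← integral_const_mul]
  refine setIntegral_congr_fun measurableSet_Ioi fun τ hτ => ?_
  rw [ellipticalRadon_of_pos ha hf u hτ]
  ring

lemma evalTime_sq (a : Fin (d + 1) → ℝ) (x' : EuclideanSpace ℝ (Fin d)) (xn : ℝ)
    (α : EuclideanSpace ℝ (Fin d)) :
    evalTime a x' xn α ^ 2
      = ‖diagInv (fun i => a i.castSucc) α - diagInv (fun i => a i.castSucc) x'‖ ^ 2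
        + ((a (Fin.last d)) ^ 2)⁻¹ * xn ^ 2 := by
  rw [evalTime, Real.sq_sqrt (by positivity), diagInv_sub]

lemma integrableOn_LambdaIntegrand (ha : ∀ i, 0 < a i) (hf : Admissible f)
    (u : EuclideanSpace ℝ (Fin d)) (n : ℕ) (t β : ℝ) :
    IntegrableOn (fun τ => LambdaIntegrand n (ellipticalRadon a f u) t β τ) (Ioi 0) := by
  refine (integrableOn_ellipticalRadon ha hf u).bdd_mul (c := |β| ^ (n - 1)) ?_
    (Eventually.of_forall fun τ => ?_)
  · exact Continuous.aestronglyMeasurable (by fun_prop)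
  · rw [norm_mul, mul_comm Complex.I, Complex.norm_exp_ofReal_mul_I, one_mul, Complex.norm_real,
      norm_pow, Real.norm_eq_abs, abs_abs]

/-- With `β = 2πb` and `s = τ²`, the `τ`-integral is a Fourier transform in `s`; the evaluation time
satisfies `t² = |α - p|² + q` in scaled coordinates, and `|β|^d = (2π)^d |b|^d`. -/
lemma integral_LambdaIntegrand (ha : ∀ i, 0 < a i) (hf : Admissible f)
    (x' : EuclideanSpace ℝ (Fin d)) (xn : ℝ) (α : EuclideanSpace ℝ (Fin d)) (β : ℝ) :
    ∫ τ in Ioi (0 : ℝ),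
        LambdaIntegrand (d + 1) (ellipticalRadon a f α) (evalTime a x' xn α) β τ
      = (((2 * Real.pi) ^ d * ∏ i, a i : ℝ) : ℂ) * backprojectionIntegrand (scaledProfile a f)
          (diagInv (fun i => a i.castSucc) x') (((a (Fin.last d)) ^ 2)⁻¹ * xn ^ 2)
          (diagInv (fun i => a i.castSucc) α) ((2 * Real.pi)⁻¹ * β) := by
  set t := evalTime a x' xn α with ht
  have hpi : Real.pi ≠ 0 := Real.pi_ne_zero
  have h1 := setIntegral_mul_ellipticalRadon ha hf α
    (fun s => Complex.exp (Complex.I * (((t ^ 2 - s) * β : ℝ) : ℂ)) * ((|β| ^ d : ℝ) : ℂ))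
  simp only [LambdaIntegrand, Nat.add_sub_cancel]
  rw [h1]
  simp only [backprojectionIntegrand]
  rw [← evalTime_sq, ← ht, finrank_euclideanSpace_fin, ← radiusSqDensity,
    Real.fourier_real_eq_integral_exp_smul]
  have h2 : ∀ s, Complex.exp (Complex.I * (((t ^ 2 - s) * β : ℝ) : ℂ)) * ((|β| ^ d : ℝ) : ℂ)
        * radiusSqDensity a f α s
      = ((|β| ^ d : ℝ) : ℂ) *
        Complex.exp (((2 * Real.pi * t ^ 2 * ((2 * Real.pi)⁻¹ * β) : ℝ) : ℂ) * Complex.I) *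
        (Complex.exp (((-2 * Real.pi * s * ((2 * Real.pi)⁻¹ * β) : ℝ) : ℂ) * Complex.I)
          • radiusSqDensity a f α s) := by
    intro s
    have h3 : Complex.exp (Complex.I * (((t ^ 2 - s) * β : ℝ) : ℂ))
        = Complex.exp (((2 * Real.pi * t ^ 2 * ((2 * Real.pi)⁻¹ * β) : ℝ) : ℂ) * Complex.I) *
          Complex.exp (((-2 * Real.pi * s * ((2 * Real.pi)⁻¹ * β) : ℝ) : ℂ) * Complex.I) := by
      rw [← Complex.exp_add, ← add_mul, ← Complex.ofReal_add, mul_comm Complex.I]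
      congr 3
      field_simp
      ring
    rw [h3, smul_eq_mul]
    ring
  simp_rw [h2]
  rw [integral_const_mul]
  have h4 : |β| ^ d = (2 * Real.pi) ^ d * |(2 * Real.pi)⁻¹ * β| ^ d := by
    rw [← mul_pow, abs_mul, abs_of_pos (by positivity : 0 < (2 * Real.pi)⁻¹)]
    congr 1
    field_simp
  rw [h4]
  push_cast
  ring

lemma lambdaConverges_ellipticalRadon (ha : ∀ i, 0 < a i) (hf : Admissible f)
    (x' : EuclideanSpace ℝ (Fin d)) (xn : ℝ) (α : EuclideanSpace ℝ (Fin d)) :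
    LambdaConverges (d + 1) (ellipticalRadon a f α) (evalTime a x' xn α) := by
  refine ⟨fun β => integrableOn_LambdaIntegrand ha hf α _ _ β, ?_⟩
  simp_rw [integral_LambdaIntegrand ha hf x' xn α]
  refine Integrable.const_mul ?_ _
  exact (integrable_backprojectionIntegrand (contDiff_scaledProfile ha hf)
    (hasCompactSupport_scaledProfile ha hf) _ _ _).comp_mul_left' (by positivity)

lemma Lambda_ellipticalRadon (ha : ∀ i, 0 < a i) (hf : Admissible f)
    (x' : EuclideanSpace ℝ (Fin d)) (xn : ℝ) (α : EuclideanSpace ℝ (Fin d)) :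
    Lambda (d + 1) (ellipticalRadon a f α) (evalTime a x' xn α)
      = (((2 * Real.pi) ^ (d + 1) * ∏ i, a i : ℝ) : ℂ) *
        ∫ b, backprojectionIntegrand (scaledProfile a f)
          (diagInv (fun i => a i.castSucc) x') (((a (Fin.last d)) ^ 2)⁻¹ * xn ^ 2)
          (diagInv (fun i => a i.castSucc) α) b := by
  rw [Lambda]
  simp_rw [integral_LambdaIntegrand ha hf x' xn α]
  -- Here `dβ = 2π db` raises the power of `2π` from `d` to `d + 1`.
  rw [integral_const_mul, Measure.integral_comp_mul_left, inv_inv,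
    abs_of_pos (by positivity), Complex.real_smul, ← mul_assoc, ← Complex.ofReal_mul]
  congr 2
  ring

lemma scaledProfile_apply (ha : ∀ i, 0 < a i) (hf : Admissible f)
    (x' : EuclideanSpace ℝ (Fin d)) {xn : ℝ} (hx : xn ≠ 0) :
    scaledProfile a f (diagInv (fun i => a i.castSucc) x', ((a (Fin.last d)) ^ 2)⁻¹ * xn ^ 2)
      = ((a (Fin.last d) / |xn| : ℝ) : ℂ) * f (point x' xn) := by
  have han := ha (Fin.last d)
  have hxa : 0 < |xn| := abs_pos.2 hx
  have hsqrt : √(((a (Fin.last d)) ^ 2)⁻¹ * xn ^ 2) = (a (Fin.last d))⁻¹ * |xn| := by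
    rw [← sq_abs xn, ← inv_pow, ← mul_pow, Real.sqrt_sq (by positivity)]
  have heven : f (point x' |xn|) = f (point x' xn) := by
    rcases abs_choice xn with h | h <;> rw [h]
    exact hf.even x' xn
  rw [scaledProfile, squareProfile, if_pos (by positivity), hsqrt, ← diagInv_point,
    diagInv_inv_diagInv ha, heven]
  push_cast
  field_simp

theorem inversion_formula (ha : ∀ i, 0 < a i) (hf : Admissible f)
    (x' : EuclideanSpace ℝ (Fin d)) (xn : ℝ) :
    Integrable (fun α => Lambda (d + 1) (ellipticalRadon a f α) (evalTime a x' xn α)) ∧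
    f (point x' xn) = ((|xn| / (2 * Real.pi ^ (d + 1) * (∏ i, a i) ^ 2) : ℝ) : ℂ)
      * ∫ α, Lambda (d + 1) (ellipticalRadon a f α) (evalTime a x' xn α) := by
  have ha' : ∀ i : Fin d, 0 < a i.castSucc := fun i => ha _
  obtain ⟨h1, h2⟩ := integrable_integral_backprojection (contDiff_scaledProfile ha hf)
    (hasCompactSupport_scaledProfile ha hf) (diagInv (fun i => a i.castSucc) x')
    (((a (Fin.last d)) ^ 2)⁻¹ * xn ^ 2)
  simp_rw [Lambda_ellipticalRadon ha hf x' xn]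
  refine ⟨(integrable_comp_diagInv ha' h1).const_mul _, ?_⟩
  -- On the hyperplane both sides vanish: `f` by its support, the right side by the factor `|xn|`.
  -- Elsewhere the profile formula, which divides by `|xn|`, applies.
  rcases eq_or_ne xn 0 with rfl | hx
  · have : point x' 0 ∉ tsupport f := fun h => hf.support_subset h (point_last x' 0)
    rw [image_eq_zero_of_notMem_tsupport this]
    simp
  · rw [integral_const_mul, integral_comp_diagInv ha' (fun y => ∫ b, backprojectionIntegrand
      (scaledProfile a f) (diagInv (fun i => a i.castSucc) x')
      (((a (Fin.last d)) ^ 2)⁻¹ * xn ^ 2) y b), h2, scaledProfile_apply ha hf x' hx,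
      finrank_euclideanSpace_fin, Fin.prod_univ_castSucc]
    have hP : 0 < ∏ i : Fin d, a i.castSucc := Finset.prod_pos fun i _ => ha' i
    have han := ha (Fin.last d)
    have hxa : 0 < |xn| := abs_pos.2 hx
    set p := ∏ i : Fin d, a i.castSucc
    -- The factors are: `(2π)^(d+1) ∏ a i` from `Λ` and the Radon transform, a second `p` from
    -- scaling `α`, `2^(-d)` from `η = -2bα`, and `a_n/|xn|` from the profile.
    have hc : |xn| / (2 * Real.pi ^ (d + 1) * (p * a (Fin.last d)) ^ 2) *
        (((2 * Real.pi) ^ (d + 1) * (p * a (Fin.last d))) *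
          (p * ((2 ^ d)⁻¹ * (a (Fin.last d) / |xn|)))) = 1 := by
      have := Real.pi_pos
      field_simp
      ring
    rw [← Complex.ofReal_inv]
    calc f (point x' xn) = ((1 : ℝ) : ℂ) * f (point x' xn) := by simp
      _ = _ := by
        rw [← hc]
        simp only [Complex.ofReal_mul]
        ring

/-- Under `s = t²` the truncation `|c - t²| > ε` becomes `|c - s| > ε`, so the finite part is that
of the density `ρ` against `(c - s)⁻²`. The divergent coefficient is `2ρ(c) ∏ a i`. -/
lemma hasFinitePart_ellipticalRadon (ha : ∀ i, 0 < a i) (hf : Admissible f)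
    (u : EuclideanSpace ℝ (Fin d)) (c : ℝ) :
    HasFinitePart (ellipticalRadon a f u) c (((∏ i, a i : ℝ) : ℂ) *
      (-(2 * Real.pi ^ 2) * ∫ b : ℝ, ((|b| : ℝ) : ℂ) *
          (Complex.exp (((2 * Real.pi * c * b : ℝ) : ℂ) * Complex.I)
            * 𝓕 (radiusSqDensity a f u) b))) := by
  have hset : ∀ ε : ℝ, MeasurableSet {t : ℝ | 0 < t ∧ ε < |c - t ^ 2|} := fun ε => by
    have hm : Measurable fun t : ℝ => |c - t ^ 2| := by fun_prop
    exact measurableSet_Ioi.inter (measurableSet_lt measurable_const hm)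
  refine ⟨fun ε hε => ?_, ((∏ i, a i : ℝ) : ℂ) * (2 * radiusSqDensity a f u c), ?_⟩
  · have h1 : IntegrableOn (ellipticalRadon a f u) {t : ℝ | 0 < t ∧ ε < |c - t ^ 2|} :=
      (integrableOn_ellipticalRadon ha hf u).mono_set fun t ht => ht.1
    simp_rw [div_eq_mul_inv]
    have hm : Measurable fun t : ℝ => ((((c - t ^ 2) ^ 2 : ℝ) : ℂ))⁻¹ := by fun_prop
    refine Integrable.mul_bdd (c := (ε ^ 2)⁻¹) h1 hm.aestronglyMeasurable ?_
    filter_upwards [ae_restrict_mem (hset ε)] with t ht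
    have : ε < |c - t ^ 2| := ht.2
    rw [norm_inv, Complex.norm_real, norm_pow, Real.norm_eq_abs]
    gcongr
  · have hG := contDiff_scaledProfile ha hf
    have hc := hasCompactSupport_scaledProfile ha hf
    have hF : Integrable (𝓕 (radiusSqDensity a f u)) := by
      simpa [radiusSqDensity] using integrable_pow_mul_fourier_paraboloidIntegral hG hc 0
        (diagInv (fun i => a i.castSucc) u)
    have hF' : Integrable fun b : ℝ => ((|b| : ℝ) : ℂ) * 𝓕 (radiusSqDensity a f u) b := by
      simpa [radiusSqDensity] using integrable_pow_mul_fourier_paraboloidIntegral hG hc 1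
        (diagInv (fun i => a i.castSucc) u)
    have h := (tendsto_finitePart (continuous_radiusSqDensity ha hf u)
      (integrable_radiusSqDensity ha hf u) hF hF' c).const_mul ((∏ i, a i : ℝ) : ℂ)
    refine h.congr fun ε => ?_
    rw [mul_sub, mul_div_assoc' _ (2 * _)]
    congr 1
    have hset' : MeasurableSet {s : ℝ | ε < |c - s|} :=
      measurableSet_lt measurable_const (by fun_prop)
    have h2 := setIntegral_mul_ellipticalRadon ha hf u
      (indicator {s : ℝ | ε < |c - s|} fun s => ((((c - s) ^ 2 : ℝ) : ℂ))⁻¹)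
    calc _ = ((∏ i, a i : ℝ) : ℂ) * ∫ s, (indicator {s : ℝ | ε < |c - s|}
            fun s => ((((c - s) ^ 2 : ℝ) : ℂ))⁻¹) s * radiusSqDensity a f u s := by
          rw [← integral_indicator hset']
          congr 2 with s
          by_cases hs : ε < |c - s| <;> simp [indicator, hs, div_eq_mul_inv, mul_comm]
      _ = _ := by
          rw [← h2, ← integral_indicator (hset ε), ← integral_indicator measurableSet_Ioi]
          congr 1 with t
          by_cases ht : 0 < t <;> by_cases hs : ε < |c - t ^ 2| <;>
            simp [indicator, hs, ht, div_eq_mul_inv, mul_comm]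

/-! ### The case `n = 2`. -/

section Planar

lemma toEuclideanFinOne_eq : (fun α : ℝ => (!₂[α] : EuclideanSpace ℝ (Fin 1)))
    = MeasurableEquiv.toLp 2 (Fin 1 → ℝ) ∘ (MeasurableEquiv.funUnique (Fin 1) ℝ).symm := by
  funext α
  ext i
  fin_cases i
  rfl

lemma measurePreserving_toEuclideanFinOne :
    MeasurePreserving (fun α : ℝ => (!₂[α] : EuclideanSpace ℝ (Fin 1))) := by
  rw [toEuclideanFinOne_eq]
  exact (PiLp.volume_preserving_toLp (Fin 1)).comp (volume_preserving_funUnique (Fin 1) ℝ).symm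

lemma measurableEmbedding_toEuclideanFinOne :
    MeasurableEmbedding (fun α : ℝ => (!₂[α] : EuclideanSpace ℝ (Fin 1))) := by
  rw [toEuclideanFinOne_eq]
  exact (MeasurableEquiv.toLp 2 (Fin 1 → ℝ)).measurableEmbedding.comp
    (MeasurableEquiv.funUnique (Fin 1) ℝ).symm.measurableEmbedding

lemma point_toEuclideanFinOne (x₁ x₂ : ℝ) :
    point (!₂[x₁] : EuclideanSpace ℝ (Fin 1)) x₂ = !₂[x₁, x₂] := by
  ext i
  fin_cases i <;> rfl

/-- For `d = 1` the weight in `Λ` is `|b|`, so both sides are multiples of the same integral: `-2π²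
∏ a i` for the finite part against `(2π)² ∏ a i` for `Λ`, with ratio `-1/2`. -/
lemma hasFinitePart_eq_Lambda {a₁ a₂ : ℝ} (h₁ : 0 < a₁) (h₂ : 0 < a₂)
    {f : EuclideanSpace ℝ (Fin 2) → ℂ} (hf : Admissible (d := 1) f) (x₁ x₂ α : ℝ) :
    HasFinitePart (ellipticalRadon (d := 1) ![a₁, a₂] f (!₂[α]))
      (|a₁⁻¹ * (α - x₁)| ^ 2 + (a₂ ^ 2)⁻¹ * x₂ ^ 2)
      (-(1 / 2) * Lambda 2 (ellipticalRadon (d := 1) ![a₁, a₂] f (!₂[α]))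
        (evalTime (d := 1) ![a₁, a₂] (!₂[x₁]) x₂ (!₂[α]))) := by
  have ha : ∀ i : Fin 2, 0 < ![a₁, a₂] i := by
    intro i
    fin_cases i <;> simpa
  convert hasFinitePart_ellipticalRadon (d := 1) ha hf (!₂[α]) _ using 1
  rw [Lambda_ellipticalRadon (d := 1) ha hf]
  have hc : ‖diagInv (fun i : Fin 1 => ![a₁, a₂] i.castSucc) (!₂[α])
        - diagInv (fun i : Fin 1 => ![a₁, a₂] i.castSucc) (!₂[x₁])‖ ^ 2
        + ((![a₁, a₂] (Fin.last 1)) ^ 2)⁻¹ * x₂ ^ 2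
      = |a₁⁻¹ * (α - x₁)| ^ 2 + (a₂ ^ 2)⁻¹ * x₂ ^ 2 := by
    simp [EuclideanSpace.norm_sq_eq, Fin.last, mul_sub]
  simp only [backprojectionIntegrand, finrank_euclideanSpace_fin, pow_one, hc]
  rw [← radiusSqDensity]
  push_cast
  ring

end Planar

end Radon

end

end EllipticalRadon

theorem mainTheorem1 :
    -- the inversion formula in dimension `n = d + 1 ≥ 2`
    (∀ (d : ℕ), 1 ≤ d → ∀ (a : Fin (d + 1) → ℝ), (∀ i, 0 < a i) →
      ∀ (f : EuclideanSpace ℝ (Fin (d + 1)) → ℂ), Admissible f →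
        (∀ (u : EuclideanSpace ℝ (Fin d)) (t : ℝ), 0 ≤ t →
          HasDeltaIntegral (ellipsoidalRadius a u) t f (ellipticalRadon a f u t)) ∧
        ∀ (x' : EuclideanSpace ℝ (Fin d)) (xn : ℝ),
          (∀ α, LambdaConverges (d + 1) (ellipticalRadon a f α) (evalTime a x' xn α)) ∧
          Integrable (fun α => Lambda (d + 1) (ellipticalRadon a f α) (evalTime a x' xn α)) ∧
          f (point x' xn) = ((|xn| / (2 * Real.pi ^ (d + 1) * (∏ i, a i) ^ 2) : ℝ) : ℂ)
            * ∫ α, Lambda (d + 1) (ellipticalRadon a f α) (evalTime a x' xn α)) ∧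
    -- the kernel formula in dimension `n = 2`
    (∀ (a₁ a₂ : ℝ), 0 < a₁ → 0 < a₂ →
      ∀ (f : EuclideanSpace ℝ (Fin 2) → ℂ), Admissible (d := 1) f →
        ∀ (x₁ x₂ : ℝ), ∃ K : ℝ → ℂ,
          (∀ α : ℝ, HasFinitePart (ellipticalRadon (d := 1) ![a₁, a₂] f (!₂[α]))
            (|a₁⁻¹ * (α - x₁)| ^ 2 + (a₂ ^ 2)⁻¹ * x₂ ^ 2) (K α)) ∧
          Integrable K ∧
          f (!₂[x₁, x₂]) = -((|x₂| / (Real.pi ^ 2 * a₁ ^ 2 * a₂ ^ 2) : ℝ) : ℂ) * ∫ α, K α) := by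
  refine ⟨fun d _ a ha f hf => ⟨fun u t _ => ?_, fun x' xn => ⟨fun α => ?_, ?_⟩⟩, ?_⟩
  · rw [ellipticalRadon_eq ha hf]
    exact hasDeltaIntegral_ellipsoidalRadius ha hf u t
  · exact lambdaConverges_ellipticalRadon ha hf x' xn α
  · exact inversion_formula ha hf x' xn
  · intro a₁ a₂ h₁ h₂ f hf x₁ x₂
    have ha : ∀ i : Fin 2, 0 < ![a₁, a₂] i := by
      intro i
      fin_cases i <;> simpa
    obtain ⟨hint, heq⟩ := inversion_formula (d := 1) ha hf (!₂[x₁]) x₂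
    -- The factor `-1/2` accounts for the sign of the kernel formula and for `π²` in place of `2π²`.
    refine ⟨fun α => -(1 / 2) * Lambda 2 (ellipticalRadon (d := 1) ![a₁, a₂] f (!₂[α]))
        (evalTime (d := 1) ![a₁, a₂] (!₂[x₁]) x₂ (!₂[α])),
      fun α => hasFinitePart_eq_Lambda h₁ h₂ hf x₁ x₂ α, ?_, ?_⟩
    · exact ((measurePreserving_toEuclideanFinOne.integrable_comp_emb
        measurableEmbedding_toEuclideanFinOne).2 hint).const_mul _
    · rw [point_toEuclideanFinOne, ← measurePreserving_toEuclideanFinOne.integral_comp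
        measurableEmbedding_toEuclideanFinOne] at heq
      rw [heq, integral_const_mul, ← mul_assoc]
      congr 1
      rw [Fin.prod_univ_two]
      simp only [Matrix.cons_val_zero, Matrix.cons_val_one]
      push_cast
      field_simp
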